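/- **Setting.** Let $n\in\mathbb N$ and let $\alpha>n$ be a real number. In the sum classic network creation game on the players $V=\{1,\dots,n\}$ with link price $\alpha$, a strategy of player $u$ is a set $s_u\subseteq V\setminus\{u\}$ (the nodes to which $u$ buys a link), and a strategy vector $s=(s_u)_{u\in V}$ defines the undirected graph $G_s$ on $V$ in which $u$ and $v$ are adjacent iff $v\in s_u$ or $u\in s_v$. The cost of $u$ is $c_u(s)=\alpha|s_u|+\sum_{v\ne u}d_{G_s}(u,v)$, with $d_{G_s}(u,v)=\infty$ if $u$ and $v$ are not connected. A Nash equilibrium is a strategy vector $s$ such that $c_u(s)\le c_u(s')$ for every player $u$ and every strategy vector $s'$ that differs from $s$ only in the strategy of $u$. A non-trivial biconnected component $H$ of $G_s$ is a maximal biconnected subgraph (connected, without cut vertices) having at least three vertices; $\operatorname{diam}(H)$ is its diameter, and $$\deg^+(H)=\frac1{|V(H)|}\sum_{v\in V(H)}\bigl|\{u\in V(H): u\in s_v\}\bigr|$$ is its average out-degree. **Theorem.** There are an absolute constant $R'$ and a real-valued function $d(K,\alpha)=d(K,n,\alpha)$, defined for all real $K>0$, all $n\in\mathbb N$ and all real $\alpha>n$,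 such that the following holds. 1. $d(K,\alpha)=O\!\left(K^2\left(\frac{\alpha}{\alpha-n}\right)^2\log\left(\frac{\alpha}{\alpha-n}\right)\right)$, that is, there is an absolute constant $C$ with $$|d(K,n,\alpha)|\le C\,K^2\left(\frac{\alpha}{\alpha-n}\right)^2\log\left(\frac{\alpha}{\alpha-n}\right)\quad\text{for all } K>0,\ n\in\mathbb N,\ \alpha>n.$$ 2. For all $K>0$, $n\in\mathbb N$ and $\alpha>n$, every Nash equilibrium $s$ of the game on $n$ players with link price $\alpha$, and every non-trivial biconnected component $H$ of $G_s$: if $\operatorname{diam}(H)>d(K,n,\alpha)$, then $$\deg^+(H)\le 1+\frac{R'-1}{K}.$$ -/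

import Mathlib

open scoped ENNReal

/-! The sum classic network creation game on the players `Fin n`, and biconnected components. -/

namespace NetworkCreation

/-- A strategy vector: player `u` buys the links from `u` to the elements of `buys u`,
a set of other players. -/
structure StrategyVector (n : ℕ) where
  buys : Fin n → Finset (Fin n)
  notMem_self : ∀ u, u ∉ buys u

/-- The (undirected) communication network `G_s`: `u` and `v` are adjacent iff one of them has
bought the link to the other. -/
def StrategyVector.graph {n : ℕ} (s : StrategyVector n) : SimpleGraph (Fin n) where
  Adj u v := v ∈ s.buys u ∨ u ∈ s.buys v
  symm := ⟨fun _ _ h => h.symm⟩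
  loopless := ⟨fun u h => h.elim (s.notMem_self u) (s.notMem_self u)⟩

/-- The cost `α |s_u| + ∑_{v ≠ u} d(u, v)` of player `u`; distances between vertices in different
connected components are infinite. -/
noncomputable def StrategyVector.cost {n : ℕ} (α : ℝ) (s : StrategyVector n) (u : Fin n) : ℝ≥0∞ :=
  ENNReal.ofReal α * ((s.buys u).card : ℝ≥0∞) +
    ∑ v ∈ Finset.univ.erase u, (s.graph.edist u v : ℝ≥0∞)

/-- `s` is a Nash equilibrium for the link price `α`: no player can lower her own cost by
changing only her own strategy. -/
def StrategyVector.IsNash {n : ℕ} (α : ℝ) (s : StrategyVector n) : Prop :=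
  ∀ (u : Fin n) (s' : StrategyVector n), (∀ w, w ≠ u → s'.buys w = s.buys w) →
    s.cost α u ≤ s'.cost α u

/-- A biconnected subgraph: connected, and without cut vertices. -/
def IsBiconnected {V : Type*} {G : SimpleGraph V} (H : G.Subgraph) : Prop :=
  H.Connected ∧ ∀ v ∈ H.verts, (H.deleteVerts {v}).Preconnected

/-- A biconnected component of `G` is a maximal biconnected subgraph; it is non-trivial when it
has at least three vertices, that is, when it is not a single vertex or a bridge. -/
def IsNontrivialBiconnectedComponent {V : Type*} {G : SimpleGraph V} (H : G.Subgraph) : Prop :=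
  Maximal IsBiconnected H ∧ 3 ≤ H.verts.encard

open scoped Classical in
/-- The directed degree `deg_H^+(v)`: the number of vertices of `H` to which `v` has bought a
link. -/
noncomputable def StrategyVector.outDegree {n : ℕ} (s : StrategyVector n) (H : s.graph.Subgraph)
    (v : Fin n) : ℕ :=
  {w ∈ s.buys v | w ∈ H.verts}.card

open scoped Classical in
/-- The average directed degree `deg^+(H) = ∑_{v ∈ V(H)} deg_H^+(v) / |V(H)|`. -/
noncomputable def StrategyVector.avgOutDegree {n : ℕ} (s : StrategyVector n)
    (H : s.graph.Subgraph) : ℝ :=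
  (∑ v ∈ H.verts.toFinset, (s.outDegree H v : ℝ)) / (H.verts.toFinset.card : ℝ)

end NetworkCreation

namespace NetworkCreation

/-! ### Walks that avoid a vertex -/

/-! Fix a vertex r of the block S minimising the distance sum and a breadth-first tree rooted at r.
Let Δ be the diameter of the block; the cone of a vertex is the set of its tree descendants. If a
player w of S swaps links for one link to r, her new distances are at most 1 + d(r,x), up to a
detour of 6Δ below a deleted tree edge, and the sum of the d(r,x) is at most her old distance sum.
Hence two of her links cannot both lead to cones smaller than μ = (α-n)/(24Δ) (`two_links`,
`root_two_links`), so she buys at most one link into S more than she has large children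
(`card_links_le`).

The excess thus comes from branchings among large cones and from mixed players, who have a single
large child c and one more link, to a small cone. Take first the mixed players with |cone c| ≤ a₀,
where a₀ is of order (α-n)/K. Between two nested ones lie at least K vertices of the block or at
least α/(40Δ) vertices (`nested_two_links`, `potential_add_one_le`): a short way out of the upper
cone would allow the upper player to drop both links, and without one the second link of the lower
player serves too few vertices. A potential Φ that counts vertices and block vertices pays for these
players and for all branchings, with total at most 2Φ(r) (`sum_le_potential`).

A mixed player with |cone c| > a₀ either is close to r, where large cones are few
(`card_shallow_le`), or her second link leads to a child with a moderately large cone, and such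
cones are pairwise disjoint (`card_two_children_le`).

Finally a block of large diameter has many vertices, nΔ² ≤ 100α|S|, since otherwise a link to a
well-placed vertex would pay off (`mul_sq_le_card`). Once Δ > K²αn/(α-n)², every excess term is
O(|S|/K) (`excess_bound`); the logarithm enters only through log(α/(α-n)) ≥ n/α. -/

/-- There is a walk from `y` to `x` of length at most `m` that avoids `w`. -/
def AvoidWalk {V : Type*} (G : SimpleGraph V) (w y x : V) (m : ℕ) : Prop :=
  ∃ p : G.Walk y x, w ∉ p.support ∧ p.length ≤ m

section AvoidWalk

variable {V : Type*} {G : SimpleGraph V} {w x y z : V} {k m : ℕ}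

lemma AvoidWalk.refl (h : y ≠ w) : AvoidWalk G w y y 0 :=
  ⟨.nil, by simpa using h.symm, by simp⟩

lemma AvoidWalk.mono (h : AvoidWalk G w y x m) (hk : m ≤ k) : AvoidWalk G w y x k :=
  let ⟨p, h1, h2⟩ := h; ⟨p, h1, h2.trans hk⟩

lemma AvoidWalk.trans (h : AvoidWalk G w y x m) (h' : AvoidWalk G w x z k) :
    AvoidWalk G w y z (m + k) := by
  obtain ⟨p, h1, h2⟩ := h
  obtain ⟨q, h3, h4⟩ := h'
  refine ⟨p.append q, ?_, ?_⟩
  · rw [SimpleGraph.Walk.mem_support_append_iff]; tauto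
  · rw [SimpleGraph.Walk.length_append]; omega

lemma AvoidWalk.symm (h : AvoidWalk G w y x m) : AvoidWalk G w x y m := by
  obtain ⟨p, h1, h2⟩ := h
  exact ⟨p.reverse, by simpa using h1, by simpa using h2⟩

lemma AvoidWalk.of_adj (h : G.Adj y x) (hy : y ≠ w) (hx : x ≠ w) : AvoidWalk G w y x 1 := by
  refine ⟨.cons h .nil, ?_, by simp⟩
  simp [hy.symm, hx.symm]

/-- Distances to `x` never increase along a shortest walk to `x`, so it cannot meet a vertex farther
from `x` than its start. -/
lemma AvoidWalk.of_dist_lt (hG : G.Connected) (h : G.dist z x < G.dist w x) :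
    AvoidWalk G w z x (G.dist z x) := by
  classical
  obtain ⟨p, hp⟩ := hG.exists_walk_length_eq_dist z x
  refine ⟨p, fun hw => ?_, hp.le⟩
  have h1 := SimpleGraph.dist_le (p.dropUntil w hw)
  have h2 := SimpleGraph.Walk.length_dropUntil_le_length p hw
  omega

end AvoidWalk

/-! ### Breadth-first search trees -/

/-- A breadth-first search tree of `G` rooted at `r`. -/
structure BFSTree {V : Type*} (G : SimpleGraph V) (r : V) where
  parent : V → V
  adj : ∀ x, x ≠ r → G.Adj (parent x) x
  dist_parent : ∀ x, x ≠ r → G.dist r x = G.dist r (parent x) + 1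

lemma exists_bfsTree {V : Type*} {G : SimpleGraph V} (hG : G.Connected) (r : V) :
    Nonempty (BFSTree G r) := by
  have key : ∀ x, ∃ y, x ≠ r → G.Adj y x ∧ G.dist r x = G.dist r y + 1 := by
    intro x
    by_cases hx : x = r
    · exact ⟨x, fun h => absurd hx h⟩
    obtain ⟨p, hp⟩ := hG.exists_walk_length_eq_dist x r
    cases p with
    | nil => exact absurd rfl hx
    | @cons _ y _ h q =>
      refine ⟨y, fun _ => ⟨h.symm, ?_⟩⟩
      have h1 := SimpleGraph.dist_le q
      rw [SimpleGraph.Walk.length_cons] at hp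
      have h2 := hG.dist_triangle (u := x) (v := y) (w := r)
      have h3 := SimpleGraph.dist_eq_one_iff_adj.2 h
      rw [SimpleGraph.dist_comm (u := r) (v := x), SimpleGraph.dist_comm (u := r) (v := y)]
      omega
  choose f hf using key
  exact ⟨⟨f, fun x hx => (hf x hx).1, fun x hx => (hf x hx).2⟩⟩

namespace BFSTree

variable {V : Type*} {G : SimpleGraph V} {r : V} (T : BFSTree G r)

/-- `T.Desc v x`: the vertex `x` is a descendant of `v` in the tree `T`. -/
inductive Desc (v : V) : V → Prop
  | refl : Desc v v
  | step (x : V) : x ≠ r → Desc v (T.parent x) → Desc v x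

variable {T} {u v w x y : V}

lemma Desc.trans (h : T.Desc u v) (h' : T.Desc v x) : T.Desc u x := by
  induction h' with
  | refl => exact h
  | step x hx _ ih => exact .step x hx ih

lemma Desc.depth_le (h : T.Desc v x) : G.dist r v ≤ G.dist r x := by
  induction h with
  | refl => exact le_rfl
  | step x hx _ ih => have := T.dist_parent x hx; omega

lemma Desc.eq_of_depth_le (h : T.Desc v x) (hd : G.dist r x ≤ G.dist r v) : x = v := by
  cases h with
  | refl => rfl
  | step x hx h => have := T.dist_parent x hx; have := h.depth_le; omega

lemma Desc.depth_lt (h : T.Desc v x) (hne : x ≠ v) : G.dist r v < G.dist r x := by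
  by_contra hd
  exact hne (h.eq_of_depth_le (by omega))

lemma desc_root (T : BFSTree G r) (x : V) : T.Desc r x := by
  induction hd : G.dist r x using Nat.strong_induction_on generalizing x with
  | _ d ih =>
    by_cases hx : x = r
    · rw [hx]; exact .refl
    · have := T.dist_parent x hx
      exact .step x hx (ih _ (by omega) _ rfl)

lemma Desc.linear (hu : T.Desc u x) (hv : T.Desc v x) (hd : G.dist r u ≤ G.dist r v) :
    T.Desc u v := by
  induction hv with
  | refl => exact hu
  | step x hx hv ih =>
    cases hu with
    | refl => have := T.dist_parent _ hx; have := hv.depth_le; omega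
    | step _ _ hu => exact ih hu

lemma Desc.eq_of_depth_eq (hu : T.Desc u x) (hv : T.Desc v x) (hd : G.dist r u = G.dist r v) :
    u = v :=
  ((hu.linear hv hd.le).eq_of_depth_le hd.ge).symm

lemma Desc.exists_child (h : T.Desc w x) (hne : x ≠ w) :
    ∃ c, c ≠ r ∧ T.parent c = w ∧ T.Desc c x := by
  induction h with
  | refl => exact absurd rfl hne
  | step x hx h ih =>
    by_cases hp : T.parent x = w
    · exact ⟨x, hx, hp, .refl⟩
    · obtain ⟨c, h1, h2, h3⟩ := ih hp
      exact ⟨c, h1, h2, .step x hx h3⟩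

lemma desc_parent (T : BFSTree G r) (hx : x ≠ r) : T.Desc (T.parent x) x := .step x hx .refl

lemma Desc.parent_of_ne (h : T.Desc v x) (hne : x ≠ v) : x ≠ r ∧ T.Desc v (T.parent x) := by
  cases h with
  | refl => exact absurd rfl hne
  | step x hx h => exact ⟨hx, h⟩

lemma Desc.exists_walk (h : T.Desc v x) :
    ∃ p : G.Walk v x, p.length + G.dist r v = G.dist r x ∧
      ∀ y ∈ p.support, T.Desc v y ∧ T.Desc y x := by
  induction h with
  | refl => exact ⟨.nil, by simp, by simp [Desc.refl]⟩
  | step x hx h ih =>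
    obtain ⟨p, hp, hs⟩ := ih
    refine ⟨p.concat (T.adj x hx), ?_, ?_⟩
    · have := T.dist_parent x hx
      rw [SimpleGraph.Walk.length_concat]; omega
    · intro y hy
      rw [SimpleGraph.Walk.support_concat, List.mem_append] at hy
      rcases hy with hy | hy
      · exact ⟨(hs y hy).1, (hs y hy).2.trans (T.desc_parent hx)⟩
      · rw [List.mem_singleton.1 hy]; exact ⟨.step x hx h, .refl⟩

lemma Desc.avoidWalk (h : T.Desc v x) (hw : ¬ (T.Desc v w ∧ T.Desc w x)) :
    AvoidWalk G w v x (G.dist r x - G.dist r v) := by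
  obtain ⟨p, hp, hs⟩ := h.exists_walk
  exact ⟨p, fun hw' => hw (hs w hw'), by omega⟩

lemma Desc.dist_add (hG : G.Connected) (h : T.Desc v x) :
    G.dist v x + G.dist r v = G.dist r x := by
  obtain ⟨p, hp, -⟩ := h.exists_walk
  have := SimpleGraph.dist_le p
  have := hG.dist_triangle (u := r) (v := v) (w := x)
  omega

lemma avoidWalk_root (T : BFSTree G r) (h : ¬ T.Desc w x) : AvoidWalk G w r x (G.dist r x) :=
  ((T.desc_root x).avoidWalk (fun h' => h h'.2)).mono (by omega)

end BFSTree

/-! ### Blocks -/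

/-- The properties of the vertex set `S` of a biconnected component of diameter `Δ` that are used
here. -/
structure IsBlock {V : Type*} (G : SimpleGraph V) (S : Finset V) (Δ : ℕ) : Prop where
  path_closed : ∀ ⦃u v : V⦄ (p : G.Walk u v), p.IsPath → u ∈ S → v ∈ S → u ≠ v →
    ∀ y ∈ p.support, y ∈ S
  exit : ∀ (w : V) (U : Set V) (a b : V), a ∈ S → b ∈ S → a ∈ U → b ∉ U → a ≠ w → b ≠ w →
    ∃ q p, q ∈ S ∧ p ∈ S ∧ q ∈ U ∧ p ∉ U ∧ q ≠ w ∧ p ≠ w ∧ G.Adj q p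
  dist_le : ∀ u ∈ S, ∀ v ∈ S, G.dist u v ≤ Δ
  exists_far : ∃ u ∈ S, ∃ v ∈ S, G.dist u v = Δ
  one_le : 1 ≤ Δ

namespace IsBlock

variable {V : Type*} {G : SimpleGraph V} {S : Finset V} {Δ : ℕ} {r : V} {T : BFSTree G r}
  {w x y p q : V}

/-- The tree walk from `r` through `y` to `x` is a geodesic, hence a path with both ends in the
block. -/
lemma mem_of_desc (hS : IsBlock G S Δ) (hr : r ∈ S) (hx : x ∈ S) (h : T.Desc y x) : y ∈ S := by
  by_cases hxr : x = r
  · subst hxr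
    have := h.depth_le
    rw [SimpleGraph.dist_self] at this
    rw [← h.eq_of_depth_le (by rw [SimpleGraph.dist_self]; omega)]; exact hx
  obtain ⟨p, hp, -⟩ := (T.desc_root y).exists_walk
  obtain ⟨q, hq, -⟩ := h.exists_walk
  rw [SimpleGraph.dist_self] at hp
  refine hS.path_closed (p.append q) (SimpleGraph.Walk.isPath_of_length_eq_dist _ ?_) hr hx
    (Ne.symm hxr) y ?_
  · rw [SimpleGraph.Walk.length_append]; omega
  · rw [SimpleGraph.Walk.mem_support_append_iff]; exact .inl p.end_mem_support

/-- The tree path from `w` down to `q`, the crossing edge and the tree path from `p` up to `r` form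
a path between two vertices of the block. -/
lemma mem_of_crossing (hS : IsBlock G S Δ) (hr : r ∈ S) (hw : w ∈ S) (hq : T.Desc w q)
    (hp : ¬ T.Desc w p) (hqp : G.Adj q p) : q ∈ S ∧ p ∈ S := by
  have hwr : w ≠ r := fun h => hp (h ▸ T.desc_root p)
  obtain ⟨a, ha, has⟩ := hq.exists_walk
  obtain ⟨b, hb, hbs⟩ := (T.desc_root p).exists_walk
  rw [SimpleGraph.dist_self] at hb
  have hap : a.IsPath := by
    apply SimpleGraph.Walk.isPath_of_length_eq_dist
    have h1 := SimpleGraph.dist_le a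
    obtain ⟨c, hc, -⟩ := (T.desc_root w).exists_walk
    rw [SimpleGraph.dist_self] at hc
    by_contra hne
    obtain ⟨a', ha'⟩ := (SimpleGraph.Walk.reachable a).exists_walk_length_eq_dist
    have h2 := SimpleGraph.dist_le (c.append a')
    rw [SimpleGraph.Walk.length_append] at h2
    omega
  have hbp : b.IsPath := b.isPath_of_length_eq_dist (by omega)
  -- The first half lies in the cone of `w`; an ancestor of `p` in that cone would put `p` there
  -- too.
  have hpath : (a.append (.cons hqp b.reverse)).IsPath := by
    rw [SimpleGraph.Walk.isPath_def, SimpleGraph.Walk.support_append,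
      SimpleGraph.Walk.support_cons, List.tail_cons]
    refine List.Nodup.append hap.support_nodup hbp.reverse.support_nodup ?_
    intro y hy hy'
    have h2 := (hbs y (by simpa using hy')).2
    exact hp ((has y hy).1.trans h2)
  have key := hS.path_closed _ hpath hw hr hwr
  constructor
  · apply key; rw [SimpleGraph.Walk.mem_support_append_iff]; exact .inl a.end_mem_support
  · apply key; rw [SimpleGraph.Walk.mem_support_append_iff]; right
    rw [SimpleGraph.Walk.support_cons]
    exact List.mem_cons_of_mem _ (b.reverse.start_mem_support)

end IsBlock

/-! ### Biconnected components are blocks -/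

section Biconnected

variable {V : Type*} {G : SimpleGraph V}

lemma le_deleteVerts_singleton {A B : G.Subgraph} {v : V} (h : A ≤ B) (hv : v ∉ A.verts) :
    A ≤ B.deleteVerts {v} := by
  constructor
  · intro x hx
    rw [SimpleGraph.Subgraph.deleteVerts_verts]
    exact ⟨h.1 hx, fun hxv => hv (Set.mem_singleton_iff.1 hxv ▸ hx)⟩
  · intro x y hxy
    rw [SimpleGraph.Subgraph.deleteVerts_adj]
    refine ⟨h.1 hxy.fst_mem, fun hxv => hv (Set.mem_singleton_iff.1 hxv ▸ hxy.fst_mem),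
      h.1 hxy.snd_mem, fun hxv => hv (Set.mem_singleton_iff.1 hxv ▸ hxy.snd_mem), h.2 hxy⟩

/-- Deleting `v` cuts a path into at most two pieces, each of which still contains an end. -/
lemma exists_walk_to_end_avoiding {a b : V} (p : G.Walk a b) (hp : p.IsPath) (v : V) {x : V}
    (hx : x ∈ p.support) (hxv : x ≠ v) :
    (∃ q : G.Walk x a, q.toSubgraph ≤ p.toSubgraph ∧ v ∉ q.support) ∨
      (∃ q : G.Walk x b, q.toSubgraph ≤ p.toSubgraph ∧ v ∉ q.support) := by
  classical
  induction p with
  | @nil u =>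
    obtain rfl : x = u := by simpa using hx
    exact .inl ⟨.nil, le_rfl, by simpa using hxv.symm⟩
  | @cons u u' w h p ih =>
    have hle : p.toSubgraph ≤ (SimpleGraph.Walk.cons h p).toSubgraph := le_sup_right
    by_cases hxu : x = u
    · subst hxu
      refine .inl ⟨.nil, ?_, by simpa using hxv.symm⟩
      simp only [SimpleGraph.Walk.toSubgraph, SimpleGraph.singletonSubgraph_le_iff]
      simp
    have hxp : x ∈ p.support := by
      rw [SimpleGraph.Walk.support_cons, List.mem_cons] at hx
      tauto
    rw [SimpleGraph.Walk.cons_isPath_iff] at hp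
    by_cases huv : u = v
    · subst huv
      refine .inr ⟨p.dropUntil x hxp, le_trans ?_ hle, fun hu =>
        hp.2 (p.support_dropUntil_subset_support hxp hu)⟩
      conv_rhs => rw [← p.take_spec hxp, SimpleGraph.Walk.toSubgraph_append]
      exact le_sup_right
    rcases ih hp.1 hxp with ⟨q, hq, hqv⟩ | ⟨q, hq, hqv⟩
    · refine .inl ⟨q.append (.cons h.symm .nil), ?_, ?_⟩
      · rw [SimpleGraph.Walk.toSubgraph_append]
        refine sup_le (hq.trans hle) ?_
        rw [SimpleGraph.Walk.toSubgraph_cons_nil_eq_subgraphOfAdj,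
          SimpleGraph.subgraphOfAdj_symm]
        exact le_sup_left
      · rw [SimpleGraph.Walk.mem_support_append_iff]
        have := q.end_mem_support
        simp only [SimpleGraph.Walk.support_cons, SimpleGraph.Walk.support_nil, List.mem_cons,
          List.not_mem_nil, or_false]
        rintro (h1 | h1 | h1)
        · exact hqv h1
        · exact hqv (h1 ▸ this)
        · exact huv h1.symm
    · exact .inr ⟨q, hq.trans hle, hqv⟩

lemma IsBiconnected.exists_walk {H : G.Subgraph} (hH : IsBiconnected H) (w : V) {a b : V}
    (ha : a ∈ H.verts) (hb : b ∈ H.verts) (haw : a ≠ w) (hbw : b ≠ w) :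
    ∃ p : G.Walk a b, p.toSubgraph ≤ H ∧ w ∉ p.support := by
  by_cases hw : w ∈ H.verts
  · obtain ⟨p, hp⟩ := (SimpleGraph.Subgraph.preconnected_iff_forall_exists_walk_subgraph _).1
      (hH.2 w hw) (u := a) (v := b) ⟨ha, by simpa using haw⟩ ⟨hb, by simpa using hbw⟩
    refine ⟨p, hp.trans SimpleGraph.Subgraph.deleteVerts_le, fun h => ?_⟩
    have := hp.1 (p.mem_verts_toSubgraph.2 h)
    rw [SimpleGraph.Subgraph.deleteVerts_verts] at this
    exact this.2 rfl
  · obtain ⟨p, hp⟩ := (SimpleGraph.Subgraph.preconnected_iff_forall_exists_walk_subgraph _).1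
      hH.1.preconnected ha hb
    exact ⟨p, hp, fun h => hw (hp.1 (p.mem_verts_toSubgraph.2 h))⟩

/-- Adding an ear creates no cut vertex: after deleting `v`, each vertex of the ear still reaches an
end of it in `H`. As the ends differ, some vertex of `H` other than `v` serves as a common target.
-/
lemma IsBiconnected.sup_path {H : G.Subgraph} (hH : IsBiconnected H) {a b : V} (p : G.Walk a b)
    (hp : p.IsPath) (ha : a ∈ H.verts) (hb : b ∈ H.verts) (hab : a ≠ b) :
    IsBiconnected (H ⊔ p.toSubgraph) := by
  refine ⟨SimpleGraph.Subgraph.connected_sup hH.1.preconnected p.toSubgraph_connected.preconnected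
    ⟨a, ha, by simp⟩, fun v _ => ?_⟩
  have hub : ∃ h ∈ H.verts, h ≠ v := by
    by_cases hav : a = v
    · exact ⟨b, hb, fun h => hab (hav.trans h.symm)⟩
    · exact ⟨a, ha, hav⟩
  obtain ⟨h, hhH, hhv⟩ := hub
  have key : ∀ x, x ∈ ((H ⊔ p.toSubgraph).deleteVerts {v}).verts →
      ∃ q : G.Walk x h, q.toSubgraph ≤ (H ⊔ p.toSubgraph).deleteVerts {v} := by
    intro x hx
    have hxv : x ≠ v := fun h => hx.2 h
    have fin : ∀ y, (∃ q : G.Walk x y, q.toSubgraph ≤ (H ⊔ p.toSubgraph) ∧ v ∉ q.support) →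
        y ∈ H.verts → ∃ q : G.Walk x h, q.toSubgraph ≤ (H ⊔ p.toSubgraph).deleteVerts {v} := by
      rintro y ⟨q, hq, hqv⟩ hy
      have hyv : y ≠ v := fun hh => hqv (hh ▸ q.end_mem_support)
      obtain ⟨q', hq', hqv'⟩ := hH.exists_walk v hy hhH hyv hhv
      refine ⟨q.append q', le_deleteVerts_singleton ?_ ?_⟩
      · rw [SimpleGraph.Walk.toSubgraph_append]
        exact sup_le hq (hq'.trans le_sup_left)
      · rw [SimpleGraph.Walk.mem_verts_toSubgraph, SimpleGraph.Walk.mem_support_append_iff]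
        tauto
    rcases hx.1 with hxH | hxp
    · refine fin x ⟨.nil, ?_, by simpa using hxv.symm⟩ hxH
      simp only [SimpleGraph.Walk.toSubgraph, SimpleGraph.singletonSubgraph_le_iff]
      exact .inl hxH
    · rw [SimpleGraph.Walk.mem_verts_toSubgraph] at hxp
      rcases exists_walk_to_end_avoiding p hp v hxp hxv with ⟨q, hq, hqv⟩ | ⟨q, hq, hqv⟩
      · exact fin a ⟨q, hq.trans le_sup_right, hqv⟩ ha
      · exact fin b ⟨q, hq.trans le_sup_right, hqv⟩ hb
  rw [SimpleGraph.Subgraph.preconnected_iff_forall_exists_walk_subgraph]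
  intro x y hx hy
  obtain ⟨q, hq⟩ := key x hx
  obtain ⟨q', hq'⟩ := key y hy
  refine ⟨q.append q'.reverse, ?_⟩
  rw [SimpleGraph.Walk.toSubgraph_append, SimpleGraph.Walk.toSubgraph_reverse]
  exact sup_le hq hq'

lemma IsNontrivialBiconnectedComponent.path_le {H : G.Subgraph}
    (hH : IsNontrivialBiconnectedComponent H) {a b : V} (p : G.Walk a b) (hp : p.IsPath)
    (ha : a ∈ H.verts) (hb : b ∈ H.verts) (hab : a ≠ b) : p.toSubgraph ≤ H :=
  le_sup_right.trans (hH.1.2 (hH.1.1.sup_path p hp ha hb hab) le_sup_left)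

lemma IsNontrivialBiconnectedComponent.isBlock [Finite V] (hG : G.Connected) {H : G.Subgraph}
    (hH : IsNontrivialBiconnectedComponent H) {S : Finset V} (hS : ∀ x, x ∈ S ↔ x ∈ H.verts) :
    IsBlock G S H.coe.diam := by
  have hconn : H.coe.Connected := hH.1.1.1.coe
  have hnt : Nontrivial H.verts := by
    rw [Set.nontrivial_coe_sort, ← Set.one_lt_encard_iff_nontrivial]
    exact lt_of_lt_of_le (by norm_num) hH.2
  have hne : Nonempty H.verts := inferInstance
  have hfin : H.coe.ediam ≠ ⊤ := SimpleGraph.connected_iff_ediam_ne_top.1 hconn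
  refine ⟨?_, ?_, ?_, ?_, ?_⟩
  · intro u v p hp hu hv huv y hy
    rw [hS] at *
    exact (hH.path_le p hp hu hv huv).1 (p.mem_verts_toSubgraph.2 hy)
  · intro w U a b ha hb haU hbU haw hbw
    rw [hS] at ha hb
    obtain ⟨p, hp, hpw⟩ := hH.1.1.exists_walk w ha hb haw hbw
    obtain ⟨d, hd, h1, h2⟩ := p.exists_boundary_dart U haU hbU
    have hf := p.dart_fst_mem_support_of_mem_darts hd
    have hs := p.dart_snd_mem_support_of_mem_darts hd
    refine ⟨d.fst, d.snd, ?_, ?_, h1, h2, fun h => hpw (h ▸ hf), fun h => hpw (h ▸ hs), d.adj⟩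
    · rw [hS]; exact hp.1 (p.mem_verts_toSubgraph.2 hf)
    · rw [hS]; exact hp.1 (p.mem_verts_toSubgraph.2 hs)
  · intro u hu v hv
    rw [hS] at hu hv
    refine le_trans ?_ (SimpleGraph.dist_le_diam hfin (u := ⟨u, hu⟩) (v := ⟨v, hv⟩))
    obtain ⟨p, hp⟩ := hconn.exists_walk_length_eq_dist ⟨u, hu⟩ ⟨v, hv⟩
    rw [← hp, ← SimpleGraph.Walk.length_map H.hom p]
    exact SimpleGraph.dist_le (p.map H.hom)
  · obtain ⟨⟨u, hu⟩, ⟨v, hv⟩, huv⟩ := SimpleGraph.exists_dist_eq_diam (G := H.coe)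
    refine ⟨u, (hS u).2 hu, v, (hS v).2 hv, le_antisymm ?_ ?_⟩
    · obtain ⟨p, hp⟩ := hconn.exists_walk_length_eq_dist ⟨u, hu⟩ ⟨v, hv⟩
      rw [← huv, ← hp, ← SimpleGraph.Walk.length_map H.hom p]
      exact SimpleGraph.dist_le (p.map H.hom)
    -- A geodesic of `G` between vertices of `H` lies in `H` by maximality, so distances inside `H`
    -- are those of `G`.
    · by_cases hne : u = v
      · subst hne
        rw [← huv, SimpleGraph.dist_self, SimpleGraph.dist_self]
      obtain ⟨p, hp, hpl⟩ := hG.exists_path_of_dist u v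
      have hle := hH.path_le p hp hu hv hne
      have hlen : p.mapToSubgraph.length = p.length :=
        (SimpleGraph.Walk.length_map p.toSubgraph.hom p.mapToSubgraph).symm.trans
          (congrArg SimpleGraph.Walk.length p.map_mapToSubgraph_hom)
      rw [← huv, ← hpl, ← hlen, ← SimpleGraph.Walk.length_map (SimpleGraph.Subgraph.inclusion hle)]
      exact SimpleGraph.dist_le _
  · exact Nat.one_le_iff_ne_zero.2 (SimpleGraph.diam_ne_zero_of_ediam_ne_top hfin)

end Biconnected

/-! ### Unilateral deviations -/

namespace StrategyVector

variable {n : ℕ} {s : StrategyVector n} {α : ℝ}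

/-- The strategy vector in which `w` buys the links to `B` instead. -/
def deviate (s : StrategyVector n) (w : Fin n) (B : Finset (Fin n)) (hB : w ∉ B) :
    StrategyVector n where
  buys := Function.update s.buys w B
  notMem_self u := by
    by_cases hu : u = w
    · subst hu; simpa using hB
    · rw [Function.update_of_ne hu]; exact s.notMem_self u

/-- If `w` buys the links to `B` instead, there is a walk of length at most `m` from `w` to `x`
which visits `w` only at its start. -/
def Reaches (s : StrategyVector n) (w : Fin n) (B : Finset (Fin n)) (x : Fin n) (m : ℕ) : Prop :=
  ∃ y k, (y ∈ B ∨ w ∈ s.buys y) ∧ k + 1 ≤ m ∧ AvoidWalk s.graph w y x k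

lemma Reaches.mono {w x : Fin n} {B : Finset (Fin n)} {m m' : ℕ} (h : s.Reaches w B x m)
    (hm : m ≤ m') : s.Reaches w B x m' :=
  let ⟨y, k, h1, h2, h3⟩ := h; ⟨y, k, h1, h2.trans hm, h3⟩

lemma Reaches.trans {w x z : Fin n} {B : Finset (Fin n)} {m k : ℕ} (h : s.Reaches w B x m)
    (h' : AvoidWalk s.graph w x z k) : s.Reaches w B z (m + k) :=
  let ⟨y, l, h1, h2, h3⟩ := h; ⟨y, l + k, h1, by omega, h3.trans h'⟩

lemma Reaches.of_mem {w y : Fin n} {B : Finset (Fin n)} (h : y ∈ B ∨ w ∈ s.buys y)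
    (hy : y ≠ w) : s.Reaches w B y 1 :=
  ⟨y, 0, h, le_rfl, .refl hy⟩

lemma graph_adj {u v : Fin n} : s.graph.Adj u v ↔ v ∈ s.buys u ∨ u ∈ s.buys v := Iff.rfl

/-- The sum of the distances from `w`. -/
noncomputable def distSum (s : StrategyVector n) (w : Fin n) : ℝ := ∑ x, (s.graph.dist w x : ℝ)

/-- A deviation of `w` changes only edges at `w`, so walks avoiding `w` survive; links that others
bought to `w` survive as well. -/
lemma Reaches.edist_le {w x : Fin n} {B : Finset (Fin n)} {m : ℕ} (hB : w ∉ B)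
    (h : s.Reaches w B x m) : (s.deviate w B hB).graph.edist w x ≤ m := by
  obtain ⟨y, k, hy, hk, p, hp, hpl⟩ := h
  have hyw : y ≠ w := fun hh => hp (hh ▸ p.start_mem_support)
  have hadj : (s.deviate w B hB).graph.Adj w y := by
    rw [graph_adj]
    simp only [deviate, Function.update_self, Function.update_of_ne hyw]
    exact hy
  have htr : ∀ e ∈ p.edges, e ∈ (s.deviate w B hB).graph.edgeSet := by
    intro e he
    induction e with
    | _ a b =>
      have ha := p.fst_mem_support_of_mem_edges he
      have hb := p.snd_mem_support_of_mem_edges he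
      have hab := p.adj_of_mem_edges he
      have haw : a ≠ w := fun hh => hp (hh ▸ ha)
      have hbw : b ≠ w := fun hh => hp (hh ▸ hb)
      rw [SimpleGraph.mem_edgeSet, graph_adj]
      simp only [deviate, Function.update_of_ne haw, Function.update_of_ne hbw]
      exact hab
  refine (SimpleGraph.edist_le (.cons hadj (p.transfer _ htr))).trans ?_
  rw [SimpleGraph.Walk.length_cons, SimpleGraph.Walk.length_transfer]
  exact_mod_cast (by omega : p.length + 1 ≤ m)

/-- In a disconnected network every player has infinite cost somewhere to lose: buying all links
makes her cost finite. -/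
lemma IsNash.connected (hs : s.IsNash α) (hn : Nonempty (Fin n)) : s.graph.Connected := by
  rw [SimpleGraph.connected_iff]
  refine ⟨fun u v => ?_, hn⟩
  by_contra huv
  have huv' : v ≠ u := fun h => huv (h ▸ .rfl)
  have hB : u ∉ Finset.univ.erase u := Finset.notMem_erase _ _
  have h1 := hs u (s.deviate u (Finset.univ.erase u) hB)
    (fun w hw => by simp only [deviate, Function.update_of_ne hw])
  have h2 : s.cost α u = ⊤ := by
    rw [cost, ENNReal.add_eq_top]
    right
    rw [ENNReal.sum_eq_top]
    exact ⟨v, Finset.mem_erase.2 ⟨huv', Finset.mem_univ _⟩, by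
      rw [SimpleGraph.edist_eq_top_of_not_reachable huv]; rfl⟩
  rw [h2, top_le_iff, cost, ENNReal.add_eq_top] at h1
  rcases h1 with h1 | h1
  · exact ENNReal.mul_ne_top ENNReal.ofReal_ne_top (ENNReal.natCast_ne_top _) h1
  · rw [ENNReal.sum_eq_top] at h1
    obtain ⟨x, hx, hx'⟩ := h1
    have := Reaches.edist_le hB (Reaches.of_mem (s := s) (.inl hx) (Finset.ne_of_mem_erase hx))
    have h3 : (s.deviate u (Finset.univ.erase u) hB).graph.edist u x = ⊤ := by
      simpa using hx'
    rw [h3] at this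
    simp at this

lemma cost_eq (hα : 0 ≤ α) (hG : s.graph.Connected) (w : Fin n) :
    s.cost α w = ENNReal.ofReal (α * (s.buys w).card + s.distSum w) := by
  have hD : s.distSum w = ∑ x ∈ Finset.univ.erase w, (s.graph.dist w x : ℝ) := by
    rw [distSum, ← Finset.add_sum_erase _ _ (Finset.mem_univ w)]
    simp
  rw [cost, ENNReal.ofReal_add (by positivity) (by rw [distSum]; positivity),
    ENNReal.ofReal_mul hα, ENNReal.ofReal_natCast, hD, ENNReal.ofReal_sum_of_nonneg (by simp)]
  congr 1
  refine Finset.sum_congr rfl fun x _ => ?_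
  rw [ENNReal.ofReal_natCast, ← (hG w x).coe_dist_eq_edist]
  simp

/-- In an equilibrium, a player does not gain by buying the links to `B` instead. -/
lemma IsNash.le_deviate (hs : s.IsNash α) (hα : 0 ≤ α) (hG : s.graph.Connected) {w : Fin n}
    {B : Finset (Fin n)} (hB : w ∉ B) (g : Fin n → ℕ) (hg : ∀ x, x ≠ w → s.Reaches w B x (g x)) :
    α * (s.buys w).card + s.distSum w ≤ α * B.card + ∑ x, (g x : ℝ) := by
  have h1 := hs w (s.deviate w B hB) (fun w hw => by simp only [deviate, Function.update_of_ne hw])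
  rw [cost_eq hα hG] at h1
  have h2 : (s.deviate w B hB).cost α w ≤ ENNReal.ofReal (α * B.card + ∑ x, (g x : ℝ)) := by
    rw [cost, ENNReal.ofReal_add (by positivity) (by positivity), ENNReal.ofReal_mul hα,
      ENNReal.ofReal_natCast, ENNReal.ofReal_sum_of_nonneg (by simp)]
    refine add_le_add (by simp [deviate]) ?_
    refine le_trans (Finset.sum_le_sum fun x hx => ?_)
      (Finset.sum_le_sum_of_subset (Finset.subset_univ _))
    have := Reaches.edist_le hB (hg x (Finset.ne_of_mem_erase hx))
    rw [ENNReal.ofReal_natCast]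
    exact_mod_cast this
  exact (ENNReal.ofReal_le_ofReal_iff (by positivity)).1 (h1.trans h2)

end StrategyVector

set_option linter.unusedSectionVars false

/-! ### Cones -/

namespace BFSTree

variable {V : Type*} {G : SimpleGraph V} {r : V} {w x a b c : V}

open scoped Classical in
/-- The descendants of `v`. -/
noncomputable def cone [Fintype V] (T : BFSTree G r) (v : V) : Finset V := {x | T.Desc v x}

open scoped Classical in
/-- The descendants of `a` if `a` is a child of `w`. -/
noncomputable def coneOf [Fintype V] (T : BFSTree G r) (w a : V) : Finset V :=
  if a ≠ r ∧ T.parent a = w then T.cone a else ∅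

variable [Fintype V] {T : BFSTree G r}

@[simp] lemma mem_cone : x ∈ T.cone w ↔ T.Desc w x := by simp [cone]

lemma mem_coneOf : x ∈ T.coneOf w a ↔ a ≠ r ∧ T.parent a = w ∧ T.Desc a x := by
  by_cases h : a ≠ r ∧ T.parent a = w
  · rw [coneOf, if_pos h, mem_cone]; tauto
  · rw [coneOf, if_neg h]; simp; tauto

lemma coneOf_eq (har : a ≠ r) (ha : T.parent a = w) : T.coneOf w a = T.cone a := by
  rw [coneOf, if_pos ⟨har, ha⟩]

lemma eq_of_siblings (har : a ≠ r) (hbr : b ≠ r) (hab : T.parent a = T.parent b)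
    (ha : T.Desc a x) (hb : T.Desc b x) : a = b := by
  refine ha.eq_of_depth_eq hb ?_
  rw [T.dist_parent a har, T.dist_parent b hbr, hab]

lemma notMem_coneOf_of_desc (hcr : c ≠ r) (hc : T.parent c = w) (hx : T.Desc c x) (hca : c ≠ a) :
    x ∉ T.coneOf w a := by
  intro h
  obtain ⟨h1, h2, h3⟩ := mem_coneOf.1 h
  exact hca (eq_of_siblings hcr h1 (hc.trans h2.symm) hx h3)

lemma not_desc_parent (T : BFSTree G r) (h : x ≠ r) : ¬ T.Desc x (T.parent x) := fun h' => by
  have := h'.depth_le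
  have := T.dist_parent x h
  omega

end BFSTree

/-! ### Inequalities satisfied by the players of a block -/

lemma sum_ite_mem_const {n : ℕ} (A : Finset (Fin n)) (k : ℝ) :
    ∑ x, (if x ∈ A then k else 0) = A.card * k := by simp

/-- A Nash equilibrium with link price `α > n`, a block `S` of its network, and a vertex `r` of `S`
minimizing the sum of the distances. -/
structure RootedBlock {n : ℕ} (s : StrategyVector n) (α : ℝ) (S : Finset (Fin n)) (Δ : ℕ)
    (r : Fin n) : Prop where
  nash : s.IsNash α
  lt : (n : ℝ) < α
  conn : s.graph.Connected
  block : IsBlock s.graph S Δ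
  root_mem : r ∈ S
  distSum_le : ∀ w ∈ S, s.distSum r ≤ s.distSum w

namespace RootedBlock

variable {n : ℕ} {s : StrategyVector n} {α : ℝ} {S : Finset (Fin n)} {Δ : ℕ} {r : Fin n}
  (R : RootedBlock s α S Δ r) (T : BFSTree s.graph r) {w a b c v x p : Fin n}
  {B : Finset (Fin n)} {m m₀ : ℕ}

include R

lemma pos : 0 < α := lt_of_le_of_lt (Nat.cast_nonneg n) R.lt

lemma depth_le (hx : x ∈ S) : s.graph.dist r x ≤ Δ := R.block.dist_le r R.root_mem x hx

lemma le_deviate (hB : w ∉ B) (g : Fin n → ℕ) (hg : ∀ x, x ≠ w → s.Reaches w B x (g x)) :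
    α * (s.buys w).card + s.distSum w ≤ α * B.card + ∑ x, (g x : ℝ) :=
  R.nash.le_deviate R.pos.le R.conn hB g hg

lemma mem_of_desc {T : BFSTree s.graph r} (hx : x ∈ S) (h : T.Desc p x) : p ∈ S :=
  R.block.mem_of_desc R.root_mem hx h

omit R in
lemma kept (hc : c ≠ r) (hB : ∀ y ∈ s.buys (T.parent c), y ≠ a → y ≠ b → y ∈ B) (hca : c ≠ a)
    (hcb : c ≠ b) : c ∈ B ∨ T.parent c ∈ s.buys c :=
  (T.adj c hc).imp (fun h => hB c h hca hcb) id

lemma reaches_of_child (hcr : c ≠ r) (hc : T.parent c = w) (hk : c ∈ B ∨ w ∈ s.buys c)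
    (hx : T.Desc c x) : s.Reaches w B x (s.graph.dist w x) := by
  subst hc
  have hd := T.dist_parent c hcr
  have h1 : s.Reaches (T.parent c) B c 1 := .of_mem hk (T.adj c hcr).symm.ne
  refine (h1.trans (hx.avoidWalk (w := T.parent c)
    (fun h => T.not_desc_parent hcr h.1))).mono ?_
  have h2 := ((T.desc_parent hcr).trans hx).dist_add R.conn
  have h3 := hx.depth_le
  omega

/-- If `a` is not a tree child of `w`, its `coneOf` is empty: deleting that link breaks no tree path
below `w`, and no vertex has to be excluded on its account. -/
lemma reaches_desc (hB : ∀ y ∈ s.buys w, y ≠ a → y ≠ b → y ∈ B) (hx : T.Desc w x) (hxw : x ≠ w)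
    (hxa : x ∉ T.coneOf w a) (hxb : x ∉ T.coneOf w b) :
    s.Reaches w B x (s.graph.dist w x) := by
  obtain ⟨c, hcr, rfl, hcx⟩ := hx.exists_child hxw
  refine R.reaches_of_child T hcr rfl (kept T hcr hB ?_ ?_) hcx
  · rintro rfl; exact hxa (BFSTree.mem_coneOf.2 ⟨hcr, rfl, hcx⟩)
  · rintro rfl; exact hxb (BFSTree.mem_coneOf.2 ⟨hcr, rfl, hcx⟩)

/-- Enter the cone of `c` through the edge from `p` to `q` and climb the tree to `c`; the climb has
length at most `Δ` because `c` and `q` lie in the block. -/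
lemma reaches_child_of_crossing {q : Fin n} (hcr : c ≠ r) (hc : T.parent c = w) (hcS : c ∈ S)
    (hq : T.Desc c q) (hqS : q ∈ S) (hpw : p ≠ w) (hqp : s.graph.Adj q p)
    (hp : s.Reaches w B p m) : s.Reaches w B c (m + 1 + Δ) := by
  subst hc
  have hqw : q ≠ T.parent c := fun h => T.not_desc_parent hcr (h ▸ hq)
  refine ((hp.trans (.of_adj hqp.symm hpw hqw)).trans (hq.avoidWalk (w := T.parent c)
    (fun h => T.not_desc_parent hcr h.1)).symm).mono ?_
  have h1 := hq.dist_add R.conn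
  have h2 := R.block.dist_le c hcS q hqS
  omega

lemma reaches_desc_child (hcr : c ≠ r) (hc : T.parent c = w) (h : s.Reaches w B c m)
    (hx : T.Desc c x) : s.Reaches w B x (m + (s.graph.dist r x - s.graph.dist r c)) := by
  subst hc
  exact h.trans (hx.avoidWalk (fun h => T.not_desc_parent hcr h.1))

/-- The cone of `c` is entered through an edge of the block avoiding `w`. That edge may start in the
other cut-off cone, whose top `a` is already reached. -/
lemma reaches_other_child (hcr : c ≠ r) (hc : T.parent c = w) (hcS : c ∈ S)
    (hout : ∀ x, x ≠ w → x ∉ T.coneOf w a → x ∉ T.coneOf w c →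
      s.Reaches w B x (m₀ + s.graph.dist r x))
    (ha : a ≠ r → T.parent a = w → s.Reaches w B a (m₀ + 2 * Δ + 1))
    {y : Fin n} (hy : y ∈ S) (hyw : y ≠ w) (hyc : y ∉ T.coneOf w c) :
    s.Reaches w B c (m₀ + 4 * Δ + 2) := by
  have hcw : c ≠ w := fun h => by
    have := T.dist_parent c hcr; rw [hc, h] at this; omega
  obtain ⟨q, p, hqS, hpS, hqU, hpU, hqw, hpw, hqp⟩ := R.block.exit w {x | x ∈ T.coneOf w c} c y
    hcS hy (BFSTree.mem_coneOf.2 ⟨hcr, hc, .refl⟩) hyc hcw hyw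
  have hp : s.Reaches w B p (m₀ + 3 * Δ + 1) := by
    have h1 := R.depth_le hpS
    by_cases hpa : p ∈ T.coneOf w a
    · obtain ⟨h2, h3, h4⟩ := BFSTree.mem_coneOf.1 hpa
      exact (R.reaches_desc_child T h2 h3 (ha h2 h3) h4).mono (by omega)
    · exact (hout p hpw hpa hpU).mono (by omega)
  exact (R.reaches_child_of_crossing T hcr hc hcS (BFSTree.mem_coneOf.1 hqU).2.2 hqS hpw hqp
    hp).mono (by omega)

/-- The vertices below two deleted tree edges can be reached by a detour. -/
lemma reaches_cone (haS : a ∈ S) (hbS : b ∈ S)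
    (hout : ∀ x, x ≠ w → x ∉ T.coneOf w a → x ∉ T.coneOf w b →
      s.Reaches w B x (m₀ + s.graph.dist r x))
    {y : Fin n} (hy : y ∈ S) (hyw : y ≠ w) (hya : y ∉ T.coneOf w a) (hyb : y ∉ T.coneOf w b)
    (hx : x ∈ T.coneOf w a ∨ x ∈ T.coneOf w b) :
    s.Reaches w B x (m₀ + s.graph.dist r x + 6 * Δ) := by
  have h1 := R.block.one_le
  have main : ∀ a b : Fin n, a ∈ S → b ∈ S → (∀ x, x ≠ w → x ∉ T.coneOf w a → x ∉ T.coneOf w b →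
      s.Reaches w B x (m₀ + s.graph.dist r x)) → y ∉ T.coneOf w a → y ∉ T.coneOf w b →
      x ∈ T.coneOf w a → s.Reaches w B x (m₀ + s.graph.dist r x + 6 * Δ) := by
    intro a b haS hbS hout hya hyb hx
    obtain ⟨har, ha, hax⟩ := BFSTree.mem_coneOf.1 hx
    have haw : a ≠ w := fun h => by
      have := T.dist_parent a har; rw [ha, h] at this; omega
    -- In the worst case the cone of `a` is reached only through that of `b`: entering `cone b` and
    -- climbing to `b` gives `m₀ + 2 * Δ + 1`, and descending, crossing and climbing to `a` at most
    -- `2 * Δ + 1` more. As `1 ≤ Δ`, the total fits into `m₀ + 6 * Δ`.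
    suffices h : s.Reaches w B a (m₀ + 4 * Δ + 2) from
      (R.reaches_desc_child T har ha h hax).mono (by omega)
    obtain ⟨q, p, hqS, hpS, hqU, hpU, hqw, hpw, hqp⟩ := R.block.exit w
      {x | x ∈ T.coneOf w a ∨ x ∈ T.coneOf w b} a y haS hy
      (.inl (BFSTree.mem_coneOf.2 ⟨har, ha, .refl⟩)) (by simp [hya, hyb]) haw hyw
    have hp : s.Reaches w B p (m₀ + s.graph.dist r p) :=
      hout p hpw (fun h => hpU (.inl h)) (fun h => hpU (.inr h))
    have hpd := R.depth_le hpS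
    rcases hqU with hq | hq
    · exact (R.reaches_child_of_crossing T har ha haS (BFSTree.mem_coneOf.1 hq).2.2 hqS hpw hqp
        hp).mono (by omega)
    · obtain ⟨hbr, hb, hbq⟩ := BFSTree.mem_coneOf.1 hq
      have hb' := R.reaches_child_of_crossing T hbr hb hbS hbq hqS hpw hqp hp
      exact R.reaches_other_child T har ha haS (fun x h1 h2 h3 => hout x h1 h3 h2)
        (fun _ _ => hb'.mono (by omega)) hy hyw hya
  rcases hx with hx | hx
  · exact main a b haS hbS hout hya hyb hx
  · exact main b a hbS haS (fun x h1 h2 h3 => hout x h1 h3 h2) hyb hya hx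

lemma reaches_outside (hr : s.Reaches w B r m₀) (hx : ¬ T.Desc w x) :
    s.Reaches w B x (m₀ + s.graph.dist r x) :=
  hr.trans (T.avoidWalk_root hx)

/-- After deleting the links to `a` and `b`, everything can be reached through the root. -/
lemma reaches_all (hwr : w ≠ r) (haS : a ∈ S) (hbS : b ∈ S)
    (hB : ∀ y ∈ s.buys w, y ≠ a → y ≠ b → y ∈ B) (hr : s.Reaches w B r m₀) (hxw : x ≠ w) :
    s.Reaches w B x (m₀ + s.graph.dist r x +
      if x ∈ T.coneOf w a ∨ x ∈ T.coneOf w b then 6 * Δ else 0) := by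
  have hrc : ∀ a, r ∉ T.coneOf w a := by
    intro a h
    obtain ⟨h1, -, h2⟩ := BFSTree.mem_coneOf.1 h
    have h3 := h2.depth_le
    rw [SimpleGraph.dist_self] at h3
    exact h1 (h2.eq_of_depth_le (by rw [SimpleGraph.dist_self]; omega)).symm
  have hout : ∀ x, x ≠ w → x ∉ T.coneOf w a → x ∉ T.coneOf w b →
      s.Reaches w B x (m₀ + s.graph.dist r x) := by
    intro x hxw hxa hxb
    by_cases hx : T.Desc w x
    · refine (R.reaches_desc T hB hx hxw hxa hxb).mono ?_
      have := hx.dist_add R.conn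
      omega
    · exact R.reaches_outside T hr hx
  split_ifs with h
  · exact R.reaches_cone T haS hbS hout R.root_mem hwr.symm (hrc a) (hrc b) h
  · push Not at h
    exact hout x hxw h.1 h.2

lemma reaches_root_of_parent (hwr : w ≠ r) (hk : T.parent w ∈ B ∨ w ∈ s.buys (T.parent w)) :
    s.Reaches w B r (s.graph.dist r w) := by
  have h1 : s.Reaches w B (T.parent w) 1 := .of_mem hk (T.adj w hwr).ne
  refine (h1.trans (T.avoidWalk_root (T.not_desc_parent hwr)).symm).mono ?_
  have := T.dist_parent w hwr
  omega

omit R in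
lemma swap_card_le (ha : a ∈ s.buys w) (y : Fin n) :
    (insert y ((s.buys w).erase a)).card ≤ (s.buys w).card := by
  have h1 := Finset.card_insert_le y ((s.buys w).erase a)
  have h2 := Finset.card_erase_add_one ha
  omega

omit R in
lemma swap_two_card_le (ha : a ∈ s.buys w) (hb : b ∈ s.buys w) (hab : a ≠ b) (y : Fin n) :
    (insert y (((s.buys w).erase a).erase b)).card + 1 ≤ (s.buys w).card := by
  have h1 := Finset.card_insert_le y (((s.buys w).erase a).erase b)
  have h2 := Finset.card_erase_add_one ha
  have h3 := Finset.card_erase_add_one (Finset.mem_erase.2 ⟨hab.symm, hb⟩)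
  omega

/-- A player with two links in the block has a large subtree below one of them. -/
lemma two_links (hwS : w ∈ S) (hwr : w ≠ r) (ha : a ∈ s.buys w) (haS : a ∈ S)
    (hb : b ∈ s.buys w) (hbS : b ∈ S) (hab : a ≠ b) :
    α - n ≤ 6 * Δ * ((T.coneOf w a).card + (T.coneOf w b).card) := by
  have hB : w ∉ insert r (((s.buys w).erase a).erase b) := by
    simp [hwr, s.notMem_self w]
  -- Replacing both links by one to `r` saves `α`. As the distance sum of `r` is minimal in the
  -- block, the loss is at most `n` for the extra step plus the detours.
  have h1 := R.le_deviate hB (fun x => 1 + s.graph.dist r x +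
      if x ∈ T.coneOf w a ∨ x ∈ T.coneOf w b then 6 * Δ else 0)
    (fun x hx => R.reaches_all T hwr haS hbS (fun y hy h1 h2 => by simp [hy, h1, h2])
      (.of_mem (.inl (by simp)) hwr.symm) hx)
  have h2 : ∑ x, ((1 + s.graph.dist r x +
      if x ∈ T.coneOf w a ∨ x ∈ T.coneOf w b then 6 * Δ else 0 : ℕ) : ℝ) ≤
      ∑ x, ((1 : ℝ) + s.graph.dist r x + ((if x ∈ T.coneOf w a then 6 * (Δ : ℝ) else 0) +
        (if x ∈ T.coneOf w b then 6 * (Δ : ℝ) else 0))) := by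
    refine Finset.sum_le_sum fun x _ => ?_
    have : (0 : ℝ) ≤ Δ := Nat.cast_nonneg _
    push_cast
    by_cases h1 : x ∈ T.coneOf w a <;> by_cases h2 : x ∈ T.coneOf w b <;> simp [h1, h2]
  rw [Finset.sum_add_distrib, Finset.sum_add_distrib, Finset.sum_add_distrib,
    sum_ite_mem_const, sum_ite_mem_const] at h2
  simp only [Finset.sum_const, Finset.card_univ, Fintype.card_fin, nsmul_eq_mul, mul_one] at h2
  have h3 : ((insert r (((s.buys w).erase a).erase b)).card : ℝ) + 1 ≤ (s.buys w).card := by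
    exact_mod_cast swap_two_card_le ha hb hab r
  have h4 := R.distSum_le w hwS
  have h5 := mul_le_mul_of_nonneg_left h3 R.pos.le
  rw [StrategyVector.distSum] at h4
  linarith

/-- If the root has two links in the block, both lead to large subtrees. -/
lemma root_two_links (ha : a ∈ s.buys r) (haS : a ∈ S) (hb : b ∈ s.buys r) (hbS : b ∈ S)
    (hab : a ≠ b) : α ≤ 6 * Δ * (T.coneOf r a).card := by
  have hbr : b ≠ r := fun h => s.notMem_self r (h ▸ hb)
  have hadj : ∀ y, y ∈ s.buys r → s.graph.dist r y = 1 := fun y hy =>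
    SimpleGraph.dist_eq_one_iff_adj.2 (.inl hy)
  have hBs : ∀ y ∈ s.buys r, y ≠ a → y ≠ a → y ∈ (s.buys r).erase a := fun y hy h _ =>
    Finset.mem_erase.2 ⟨h, hy⟩
  have hout : ∀ x, x ≠ r → x ∉ T.coneOf r a → x ∉ T.coneOf r a →
      s.Reaches r ((s.buys r).erase a) x (0 + s.graph.dist r x) := by
    intro x hx hxa _
    rw [zero_add]
    exact R.reaches_desc T hBs (T.desc_root x) hx hxa hxa
  -- The remaining neighbor `b` lies in the block outside the cone of `a`, so there is an exit from
  -- that cone avoiding `r`.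
  have hba : b ∉ T.coneOf r a := by
    intro h
    have h1 := (BFSTree.mem_coneOf.1 h).2.2
    exact hab (h1.eq_of_depth_le (by rw [hadj b hb, hadj a ha])).symm
  have h1 := R.le_deviate (w := r) (B := (s.buys r).erase a) (by simp [s.notMem_self r])
    (fun x => s.graph.dist r x + if x ∈ T.coneOf r a then 6 * Δ else 0) (fun x hx => by
      by_cases hxa : x ∈ T.coneOf r a
      · simp only [hxa, if_true]
        exact (R.reaches_cone T haS haS hout hbS hbr hba hba (.inl hxa)).mono (by omega)
      · simp only [hxa, if_false]
        exact (hout x hx hxa hxa).mono (by omega))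
  push_cast at h1
  rw [Finset.sum_add_distrib, sum_ite_mem_const] at h1
  have h3 : (((s.buys r).erase a).card : ℝ) + 1 = (s.buys r).card := by
    exact_mod_cast Finset.card_erase_add_one ha
  rw [← h3, StrategyVector.distSum] at h1
  linarith

/-- Swap the link to `v` for one to `r`, at no change in link cost. The cone of `c` keeps its
distances from `w`, which beat the route through `r` by `dist r w + 1` per vertex; by minimality of
`r` this gain is at most `n` plus the detours into the cone of `v`. -/
lemma depth_mul_cone_le (hwS : w ∈ S) (hwr : w ≠ r) (hcr : c ≠ r) (hc : T.parent c = w)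
    (hv : v ∈ s.buys w) (hvS : v ∈ S) (hcv : c ≠ v) :
    ((s.graph.dist r w : ℝ) + 1) * (T.cone c).card ≤ n + 6 * Δ * (T.coneOf w v).card := by
  have hB : w ∉ insert r ((s.buys w).erase v) := by simp [hwr, s.notMem_self w]
  have hBs : ∀ y ∈ s.buys w, y ≠ v → y ≠ v → y ∈ insert r ((s.buys w).erase v) :=
    fun y hy h1 _ => by simp [hy, h1]
  have h1 := R.le_deviate hB (fun x => if x ∈ T.cone c then s.graph.dist w x else
      1 + s.graph.dist r x + if x ∈ T.coneOf w v ∨ x ∈ T.coneOf w v then 6 * Δ else 0)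
    (fun x hx => by
      by_cases hxc : x ∈ T.cone c
      · simp only [hxc, if_true]
        subst hc
        exact R.reaches_of_child T hcr rfl (kept T hcr hBs hcv hcv) (BFSTree.mem_cone.1 hxc)
      · simp only [hxc, if_false]
        exact R.reaches_all T hwr hvS hvS hBs (.of_mem (.inl (by simp)) hwr.symm) hx)
  have h2 : ∑ x, ((if x ∈ T.cone c then s.graph.dist w x else
      1 + s.graph.dist r x + if x ∈ T.coneOf w v ∨ x ∈ T.coneOf w v then 6 * Δ else 0 : ℕ) : ℝ) ≤
      ∑ x, ((1 : ℝ) + s.graph.dist r x +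
        ((if x ∈ T.cone c then -((s.graph.dist r w : ℝ) + 1) else 0) +
        (if x ∈ T.coneOf w v then 6 * (Δ : ℝ) else 0))) := by
    refine Finset.sum_le_sum fun x _ => ?_
    by_cases h1 : x ∈ T.cone c
    · have hx := BFSTree.mem_cone.1 h1
      have h2 : x ∉ T.coneOf w v := BFSTree.notMem_coneOf_of_desc hcr hc hx hcv
      have h3 : T.Desc w x := by
        rw [← hc]; exact (T.desc_parent hcr).trans hx
      have h4 : (s.graph.dist w x : ℝ) + s.graph.dist r w = s.graph.dist r x := by
        exact_mod_cast h3.dist_add R.conn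
      simp only [h1, h2, if_true, if_false]
      linarith
    · by_cases h2 : x ∈ T.coneOf w v <;> simp [h1, h2]
  rw [Finset.sum_add_distrib, Finset.sum_add_distrib, Finset.sum_add_distrib,
    sum_ite_mem_const, sum_ite_mem_const] at h2
  simp only [Finset.sum_const, Finset.card_univ, Fintype.card_fin, nsmul_eq_mul, mul_one] at h2
  have h3 : ((insert r ((s.buys w).erase v)).card : ℝ) ≤ (s.buys w).card := by
    exact_mod_cast swap_card_le hv r
  have h4 := R.distSum_le w hwS
  have h5 := mul_le_mul_of_nonneg_left h3 R.pos.le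
  rw [StrategyVector.distSum] at h4
  linarith

/-- Delete the link to `v` and route through `r` along the surviving parent link: each vertex gets
farther by at most `2 * dist r w`, plus a detour below `v`. -/
lemma child_link (hwr : w ≠ r) (hv : v ∈ s.buys w) (hvS : v ∈ S) (hvr : v ≠ r)
    (hvw : T.parent v = w) :
    α ≤ 2 * s.graph.dist r w * n + 6 * Δ * (T.coneOf w v).card := by
  have hB : w ∉ (s.buys w).erase v := by simp [s.notMem_self w]
  have hBs : ∀ y ∈ s.buys w, y ≠ v → y ≠ v → y ∈ (s.buys w).erase v :=
    fun y hy h1 _ => by simp [hy, h1]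
  have hpv : T.parent w ≠ v := by
    intro h
    have h1 := T.dist_parent v hvr
    have h2 := T.dist_parent w hwr
    rw [hvw] at h1
    rw [h] at h2
    omega
  have hroot := R.reaches_root_of_parent (B := (s.buys w).erase v) T hwr
    ((T.adj w hwr).symm.imp (fun h => by simp [h, hpv]) id)
  have h1 := R.le_deviate hB (fun x => s.graph.dist r w + s.graph.dist r x +
      if x ∈ T.coneOf w v ∨ x ∈ T.coneOf w v then 6 * Δ else 0)
    (fun x hx => R.reaches_all T hwr hvS hvS hBs hroot hx)
  have h2 : ∑ x, ((s.graph.dist r w + s.graph.dist r x +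
      if x ∈ T.coneOf w v ∨ x ∈ T.coneOf w v then 6 * Δ else 0 : ℕ) : ℝ) ≤
      ∑ x, ((2 : ℝ) * s.graph.dist r w + s.graph.dist w x +
        (if x ∈ T.coneOf w v then 6 * (Δ : ℝ) else 0)) := by
    refine Finset.sum_le_sum fun x _ => ?_
    have : (s.graph.dist r x : ℝ) ≤ s.graph.dist r w + s.graph.dist w x := by
      exact_mod_cast R.conn.dist_triangle
    push_cast
    by_cases h2 : x ∈ T.coneOf w v <;> simp [h2] <;> linarith
  rw [Finset.sum_add_distrib, Finset.sum_add_distrib, sum_ite_mem_const] at h2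
  simp only [Finset.sum_const, Finset.card_univ, Fintype.card_fin, nsmul_eq_mul] at h2
  have h3 : (((s.buys w).erase v).card : ℝ) + 1 = (s.buys w).card := by
    exact_mod_cast Finset.card_erase_add_one hv
  rw [← h3, StrategyVector.distSum] at h1
  linarith

/-- Replace the links to `c` and `v` by one to `r`. The cone of `c` is re-entered by going from `r`
to `p` and back along the exit; since `dist r p ≤ dist r c + m`, this adds only `2 * m` instead of
the general detour. -/
lemma exit_length (hwS : w ∈ S) (hwr : w ≠ r) (hcr : c ≠ r) (hc : T.parent c = w)
    (hcb : c ∈ s.buys w) (hcS : c ∈ S) (hv : v ∈ s.buys w) (hvS : v ∈ S) (hcv : c ≠ v)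
    (hp : ¬ T.Desc w p) (hm : AvoidWalk s.graph w c p m) :
    α - n ≤ 2 * m * (T.cone c).card + 6 * Δ * (T.coneOf w v).card := by
  have hB : w ∉ insert r (((s.buys w).erase c).erase v) := by simp [hwr, s.notMem_self w]
  have hBs : ∀ y ∈ s.buys w, y ≠ c → y ≠ v → y ∈ insert r (((s.buys w).erase c).erase v) :=
    fun y hy h1 h2 => by simp [hy, h1, h2]
  have hroot : s.Reaches w (insert r (((s.buys w).erase c).erase v)) r 1 :=
    .of_mem (.inl (by simp)) hwr.symm
  have hpd : s.graph.dist r p ≤ s.graph.dist r c + m := by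
    obtain ⟨q, -, hq⟩ := hm
    have := SimpleGraph.dist_le q
    have := R.conn.dist_triangle (u := r) (v := c) (w := p)
    omega
  have hcr' := (R.reaches_outside T hroot hp).trans hm.symm
  have h1 := R.le_deviate hB (fun x => if x ∈ T.cone c then 1 + s.graph.dist r x + 2 * m else
      1 + s.graph.dist r x + if x ∈ T.coneOf w c ∨ x ∈ T.coneOf w v then 6 * Δ else 0)
    (fun x hx => by
      by_cases hxc : x ∈ T.cone c
      · simp only [hxc, if_true]
        have := (BFSTree.mem_cone.1 hxc).depth_le
        exact (R.reaches_desc_child T hcr hc hcr' (BFSTree.mem_cone.1 hxc)).mono (by omega)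
      · simp only [hxc, if_false]
        exact R.reaches_all T hwr hcS hvS hBs hroot hx)
  have h2 : ∑ x, ((if x ∈ T.cone c then 1 + s.graph.dist r x + 2 * m else
      1 + s.graph.dist r x + if x ∈ T.coneOf w c ∨ x ∈ T.coneOf w v then 6 * Δ else 0 : ℕ) : ℝ) ≤
      ∑ x, ((1 : ℝ) + s.graph.dist r x + ((if x ∈ T.cone c then 2 * (m : ℝ) else 0) +
        (if x ∈ T.coneOf w v then 6 * (Δ : ℝ) else 0))) := by
    refine Finset.sum_le_sum fun x _ => ?_
    rw [BFSTree.coneOf_eq hcr hc]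
    by_cases h1 : x ∈ T.cone c
    · by_cases h2 : x ∈ T.coneOf w v <;> simp only [h1, h2, if_true, if_false] <;> push_cast <;>
        linarith [(Nat.cast_nonneg Δ : (0 : ℝ) ≤ Δ)]
    · by_cases h2 : x ∈ T.coneOf w v <;> simp [h1, h2]
  rw [Finset.sum_add_distrib, Finset.sum_add_distrib, Finset.sum_add_distrib,
    sum_ite_mem_const, sum_ite_mem_const] at h2
  simp only [Finset.sum_const, Finset.card_univ, Fintype.card_fin, nsmul_eq_mul, mul_one] at h2
  have h3 : ((insert r (((s.buys w).erase c).erase v)).card : ℝ) + 1 ≤ (s.buys w).card := by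
    exact_mod_cast swap_two_card_le hcb hv hcv r
  have h4 := R.distSum_le w hwS
  have h5 := mul_le_mul_of_nonneg_left h3 R.pos.le
  rw [StrategyVector.distSum] at h4
  linarith

end RootedBlock

/-! ### Consecutive players with two links -/

/-- The player `w` of the block `S` has bought the links to her child `c` and to `v`. -/
structure TwoLinks {n : ℕ} {s : StrategyVector n} {r : Fin n} (S : Finset (Fin n))
    (T : BFSTree s.graph r) (w c v : Fin n) : Prop where
  mem : w ∈ S
  ne_root : w ≠ r
  child_ne_root : c ≠ r
  parent_child : T.parent c = w
  buys_child : c ∈ s.buys w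
  child_mem : c ∈ S
  buys_other : v ∈ s.buys w
  other_mem : v ∈ S
  ne : c ≠ v

namespace RootedBlock

variable {n : ℕ} {s : StrategyVector n} {α : ℝ} {S : Finset (Fin n)} {Δ : ℕ} {r : Fin n}
  (R : RootedBlock s α S Δ r) (T : BFSTree s.graph r) {w w' c c' v v' x p : Fin n}

include R

omit R in
lemma length_le_card {u u' : Fin n} (q : s.graph.Walk u u') (hq : q.IsPath)
    {A : Finset (Fin n)} {i : ℕ} (hi : i ≤ q.length + 1) (hA : ∀ j < i, q.getVert j ∈ A) :
    i ≤ A.card := by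
  have h1 : (Finset.range i).card ≤ A.card := by
    refine Finset.card_le_card_of_injOn q.getVert (fun j hj => ?_) (fun j hj k hk h => ?_)
    · exact hA j (by simpa using hj)
    · have hj' : j < i := by simpa using hj
      have hk' : k < i := by simpa using hk
      exact hq.getVert_injOn (by simp; omega) (by simp; omega) h
  simpa using h1

/-- A geodesic which leaves `cone w` other than through `w` or `cone c'` contains a short exit. -/
lemma exists_exit (hwS : w ∈ S) (hcr : c ≠ r) (hc : T.parent c = w)
    (hw'S : w' ∈ S) (hc'r : c' ≠ r) (hc' : T.parent c' = w') (hcw' : T.Desc c w')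
    (hx : ¬ T.Desc w x) (q : s.graph.Walk w' x) (hq : q.IsPath) (hqw : w ∉ q.support)
    (hqc : ∀ z ∈ q.support, ¬ T.Desc c' z) :
    ∃ p m, ¬ T.Desc w p ∧ AvoidWalk s.graph w c p m ∧
      m ≤ 2 * ((T.cone w \ T.cone c') ∩ S).card := by
  classical
  have hwc : T.Desc w c := hc ▸ T.desc_parent hcr
  have hww' : T.Desc w w' := hwc.trans hcw'
  have hex : ∃ i, ¬ T.Desc w (q.getVert i) := ⟨q.length, by simpa using hx⟩
  set i := Nat.find hex with hi
  have hpi : ¬ T.Desc w (q.getVert i) := Nat.find_spec hex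
  have hlt : ∀ j < i, T.Desc w (q.getVert j) := fun j hj => not_not.1 (Nat.find_min hex hj)
  have hil : i ≤ q.length := Nat.find_min' hex (by simpa using hx)
  have hi0 : i ≠ 0 := fun h => hpi (by rw [h]; simpa using hww')
  obtain ⟨j, hj⟩ := Nat.exists_eq_succ_of_ne_zero hi0
  have hadj : s.graph.Adj (q.getVert j) (q.getVert i) := by
    rw [hj]; exact q.adj_getVert_succ (by omega)
  have hpS : q.getVert i ∈ S := (R.block.mem_of_crossing R.root_mem hwS (hlt j (by omega)) hpi
    hadj).2
  have hne : w' ≠ q.getVert i := fun h => hpi (h ▸ hww')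
  have htake := R.block.path_closed (q.take i) (hq.take i) hw'S hpS hne
  have hsupp : ∀ k, q.getVert k ∈ q.support := fun k => q.getVert_mem_support k
  -- The vertices of the geodesic before its first exit are distinct and lie in the block between
  -- the two cones. The tree path from `c` to `w'` is counted in the same set, whence the factor 2.
  have h1 : i ≤ ((T.cone w \ T.cone c') ∩ S).card := by
    refine length_le_card q hq (by omega) fun k hk => ?_
    rw [Finset.mem_inter, Finset.mem_sdiff, BFSTree.mem_cone, BFSTree.mem_cone]
    refine ⟨⟨hlt k hk, hqc _ (hsupp k)⟩, htake _ ?_⟩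
    have h2 : (q.take i).getVert k = q.getVert k := by
      rw [SimpleGraph.Walk.take_getVert]
      congr 1; omega
    rw [← h2]
    exact (q.take i).getVert_mem_support k
  obtain ⟨t, ht, hts⟩ := hcw'.exists_walk
  have htp : t.IsPath := t.isPath_of_length_eq_dist (by have := hcw'.dist_add R.conn; omega)
  have h2 : t.length + 1 ≤ ((T.cone w \ T.cone c') ∩ S).card := by
    refine length_le_card t htp le_rfl fun k _ => ?_
    have h3 := hts _ (t.getVert_mem_support k)
    rw [Finset.mem_inter, Finset.mem_sdiff, BFSTree.mem_cone, BFSTree.mem_cone]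
    refine ⟨⟨hwc.trans h3.1, fun h4 => ?_⟩, R.mem_of_desc hw'S h3.2⟩
    exact T.not_desc_parent hc'r (hc' ▸ h4.trans h3.2)
  refine ⟨q.getVert i, t.length + i, hpi, ?_, by omega⟩
  have h5 : AvoidWalk s.graph w c w' t.length :=
    ⟨t, fun h => T.not_desc_parent hcr (hc ▸ (hts _ h).1), le_rfl⟩
  refine h5.trans ⟨q.take i, fun h => hqw ((q.isSubwalk_take i).support_subset h), ?_⟩
  rw [SimpleGraph.Walk.take_length]; omega

/-- Without short exits, all geodesics from `w'` out of `cone w` go through `w` or `cone c'`. -/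
lemma geodesic_split {k : ℕ} (hwS : w ∈ S) (hcr : c ≠ r) (hc : T.parent c = w)
    (hw'S : w' ∈ S) (hc'r : c' ≠ r) (hc' : T.parent c' = w') (hcw' : T.Desc c w')
    (hk : ((T.cone w \ T.cone c') ∩ S).card = k)
    (hno : ∀ p m, ¬ T.Desc w p → AvoidWalk s.graph w c p m → ¬ m ≤ 2 * k)
    (hx : ¬ T.Desc w x) :
    s.graph.dist w' x = s.graph.dist w' w + s.graph.dist w x ∨
      ∃ z, T.Desc c' z ∧ s.graph.dist w' x = s.graph.dist w' z + s.graph.dist z x := by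
  obtain ⟨q, hq, hql⟩ := R.conn.exists_path_of_dist w' x
  have key : ∀ z ∈ q.support, s.graph.dist w' x = s.graph.dist w' z + s.graph.dist z x := by
    intro z hz
    have h1 := SimpleGraph.dist_le (q.takeUntil z hz)
    have h2 := SimpleGraph.dist_le (q.dropUntil z hz)
    have h3 := congrArg SimpleGraph.Walk.length (q.take_spec hz)
    rw [SimpleGraph.Walk.length_append] at h3
    have h4 := R.conn.dist_triangle (u := w') (v := z) (w := x)
    omega
  by_cases hqw : w ∈ q.support
  · exact .inl (key w hqw)
  by_cases hqc : ∀ z ∈ q.support, ¬ T.Desc c' z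
  · obtain ⟨p, m, h1, h2, h3⟩ := R.exists_exit T hwS hcr hc hw'S hc'r hc' hcw' hx q hq hqw hqc
    exact absurd (hk ▸ h3) (hno p m h1 h2)
  · push Not at hqc
    obtain ⟨z, hz, hzc⟩ := hqc
    exact .inr ⟨z, hzc, key z hz⟩

/-- A geodesic from `w'` does not return to `w'` after `z`, so its remainder survives any deviation
of `w'`. -/
lemma reaches_via {B : Finset (Fin n)} {z : Fin n} (hz : z ≠ w')
    (h : s.graph.dist w' x = s.graph.dist w' z + s.graph.dist z x) {m : ℕ}
    (hr : s.Reaches w' B z m) : s.Reaches w' B x (m + s.graph.dist z x) := by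
  refine hr.trans (.of_dist_lt R.conn ?_)
  have := R.conn.pos_dist_of_ne hz.symm
  omega

/-- A crossing link of the block below `w'` leads to the root. -/
lemma reaches_root_of_children {B : Finset (Fin n)} (hw'r : w' ≠ r) (hc'r : c' ≠ r)
    (hc' : T.parent c' = w') (hc'S : c' ∈ S)
    (hB : ∀ y ∈ s.buys w', y ≠ T.parent w' → y ∈ B) : s.Reaches w' B r (2 * Δ + 1) := by
  have hc'w : c' ≠ w' := fun h => by
    have := T.dist_parent c' hc'r; rw [hc', h] at this; omega
  have hdc' : T.Desc w' c' := hc' ▸ T.desc_parent hc'r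
  have hnr : ¬ T.Desc w' r := fun h => by
    have h1 := h.depth_le
    rw [SimpleGraph.dist_self] at h1
    exact hw'r (h.eq_of_depth_le (by rw [SimpleGraph.dist_self]; omega)).symm
  obtain ⟨q, p, hqS, hpS, hqU, hpU, hqw, hpw, hqp⟩ := R.block.exit w' {x | T.Desc w' x} c' r hc'S
    R.root_mem hdc' hnr hc'w hw'r.symm
  have hpar : ∀ x, x ∉ T.coneOf w' (T.parent w') := by
    intro x h
    obtain ⟨h1, h2, -⟩ := BFSTree.mem_coneOf.1 h
    have := T.dist_parent _ h1
    have := T.dist_parent _ hw'r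
    rw [h2] at *
    omega
  have h1 := R.reaches_desc T (B := B) (a := T.parent w') (b := T.parent w')
    (fun y hy h _ => hB y hy h) hqU hqw (hpar q) (hpar q)
  refine ((h1.trans (.of_adj hqp hqw hpw)).trans (T.avoidWalk_root hpU).symm).mono ?_
  have h2 := hqU.dist_add R.conn
  have h3 := R.depth_le hqS
  have h4 := R.depth_le hpS
  omega

open scoped Classical in
/-- The vertices outside `cone w` for which there is a geodesic from `w'` through `w`. -/
noncomputable def upward (s : StrategyVector n) (T : BFSTree s.graph r) (w w' : Fin n) :
    Finset (Fin n) :=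
  {x | ¬ T.Desc w x ∧ s.graph.dist w' x = s.graph.dist w' w + s.graph.dist w x}

omit R in
lemma mem_upward : x ∈ upward s T w w' ↔
    ¬ T.Desc w x ∧ s.graph.dist w' x = s.graph.dist w' w + s.graph.dist w x := by
  simp [upward]

/-- If the parent of `w'` remains a neighbor, the deletion of the second link of `w'` only affects
the vertices between `w` and `c'`. -/
lemma link_price_le_of_kept (h' : TwoLinks S T w' c' v') (hcr : c ≠ r) (hc : T.parent c = w)
    (hcw' : T.Desc c w')
    (hsplit : ∀ x, ¬ T.Desc w x → s.graph.dist w' x = s.graph.dist w' w + s.graph.dist w x ∨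
      ∃ z, T.Desc c' z ∧ s.graph.dist w' x = s.graph.dist w' z + s.graph.dist z x)
    (hkept : T.parent w' ∈ (s.buys w').erase v' ∨ w' ∈ s.buys (T.parent w')) :
    α ≤ 8 * Δ * (T.cone w \ T.cone c').card := by
  have hB : w' ∉ (s.buys w').erase v' := by simp [s.notMem_self w']
  have hBs : ∀ y ∈ s.buys w', y ≠ v' → y ≠ v' → y ∈ (s.buys w').erase v' :=
    fun y hy h1 _ => by simp [hy, h1]
  have hww' : T.Desc w w' := hc ▸ (T.desc_parent hcr).trans hcw'
  have hwne : w' ≠ w := fun h => T.not_desc_parent hcr (by rw [hc, ← h]; exact hcw')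
  have hroot := R.reaches_root_of_parent T h'.ne_root hkept
  have hw : s.Reaches w' ((s.buys w').erase v') w (s.graph.dist w' w) := by
    have h1 := T.dist_parent w' h'.ne_root
    have h2 := (hww'.parent_of_ne hwne).2
    have h3 := h2.depth_le
    have h4 := hww'.dist_add R.conn
    refine (StrategyVector.Reaches.trans (.of_mem hkept (T.adj w' h'.ne_root).ne)
      (h2.avoidWalk (w := w') (fun h => T.not_desc_parent h'.ne_root h.2)).symm).mono ?_
    rw [SimpleGraph.dist_comm (u := w') (v := w)]
    omega
  have hc'x : ∀ x, T.Desc c' x → s.Reaches w' ((s.buys w').erase v') x (s.graph.dist w' x) :=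
    fun x hx => R.reaches_of_child T h'.child_ne_root h'.parent_child
      (.inl (by simp [h'.ne, h'.buys_child])) hx
  -- Only vertices between the cones can lose: a detour of `6 * Δ`, and at most `2 * dist r w' ≤ 2 *
  -- Δ` for routing through `r`.
  have h1 := R.le_deviate hB (fun x => if x ∈ T.cone w \ T.cone c' then
      s.graph.dist r w' + s.graph.dist r x + 6 * Δ else s.graph.dist w' x) (fun x hxw => by
    by_cases hx : x ∈ T.cone w \ T.cone c'
    · simp only [hx, if_true]
      refine (R.reaches_all T h'.ne_root h'.other_mem h'.other_mem hBs hroot hxw).mono ?_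
      split_ifs <;> omega
    · simp only [hx, if_false]
      by_cases hxc : T.Desc c' x
      · exact hc'x x hxc
      have hxw' : ¬ T.Desc w x := by simpa [hxc] using hx
      rcases hsplit x hxw' with h | ⟨z, hz, h⟩
      · rw [h]; exact R.reaches_via hwne.symm h hw
      · rw [h]
        refine R.reaches_via ?_ h (hc'x z hz)
        rintro rfl
        exact T.not_desc_parent h'.child_ne_root (h'.parent_child ▸ hz))
  have h2 : ∑ x, ((if x ∈ T.cone w \ T.cone c' then
      s.graph.dist r w' + s.graph.dist r x + 6 * Δ else s.graph.dist w' x : ℕ) : ℝ) ≤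
      ∑ x, ((s.graph.dist w' x : ℝ) +
        (if x ∈ T.cone w \ T.cone c' then 8 * (Δ : ℝ) else 0)) := by
    refine Finset.sum_le_sum fun x _ => ?_
    by_cases hx : x ∈ T.cone w \ T.cone c'
    · have h3 : (s.graph.dist r x : ℝ) ≤ s.graph.dist r w' + s.graph.dist w' x := by
        exact_mod_cast R.conn.dist_triangle
      have h4 : (s.graph.dist r w' : ℝ) ≤ Δ := by exact_mod_cast R.depth_le h'.mem
      simp only [hx, if_true]
      push_cast
      linarith
    · simp only [hx, if_false, add_zero, le_refl]
  rw [Finset.sum_add_distrib, sum_ite_mem_const] at h2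
  have h3 : (((s.buys w').erase v').card : ℝ) + 1 = (s.buys w').card := by
    exact_mod_cast Finset.card_erase_add_one h'.buys_other
  rw [← h3, StrategyVector.distSum] at h1
  linarith

/-- If the second link of `w'` leads to her parent, replacing it by a link to `w` bounds the number
of vertices reached through `w`. -/
lemma card_upward_le (h' : TwoLinks S T w' c' v') (hcr : c ≠ r) (hc : T.parent c = w)
    (hcw' : T.Desc c w')
    (hsplit : ∀ x, ¬ T.Desc w x → s.graph.dist w' x = s.graph.dist w' w + s.graph.dist w x ∨
      ∃ z, T.Desc c' z ∧ s.graph.dist w' x = s.graph.dist w' z + s.graph.dist z x)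
    (hv' : v' = T.parent w') (hfar : 2 ≤ s.graph.dist w' w) :
    ((upward s T w w').card : ℝ) ≤ 3 * (T.cone w \ T.cone c').card := by
  have hww' : T.Desc w w' := hc ▸ (T.desc_parent hcr).trans hcw'
  have hwne : w' ≠ w := fun h => T.not_desc_parent hcr (by rw [hc, ← h]; exact hcw')
  have hB : w' ∉ insert w ((s.buys w').erase v') := by simp [s.notMem_self w', hwne]
  have hBs : ∀ y ∈ s.buys w', y ≠ v' → y ≠ v' → y ∈ insert w ((s.buys w').erase v') :=
    fun y hy h1 _ => by simp [hy, h1]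
  have hw : s.Reaches w' (insert w ((s.buys w').erase v')) w 1 :=
    .of_mem (.inl (by simp)) hwne.symm
  have hpar : ∀ x, x ∉ T.coneOf w' v' := by
    intro x h
    obtain ⟨h1, h2, -⟩ := BFSTree.mem_coneOf.1 h
    rw [hv'] at h1 h2
    have := T.dist_parent _ h1
    have := T.dist_parent _ h'.ne_root
    rw [h2] at *
    omega
  have hdesc : ∀ x, T.Desc w' x → x ≠ w' →
      s.Reaches w' (insert w ((s.buys w').erase v')) x (s.graph.dist w' x) :=
    fun x hx hxw => R.reaches_desc T hBs hx hxw (hpar x) (hpar x)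
  have hdc' : T.Desc w' c' := h'.parent_child ▸ T.desc_parent h'.child_ne_root
  have hzw : ∀ z, T.Desc c' z → z ≠ w' := by
    rintro z hz rfl
    exact T.not_desc_parent h'.child_ne_root (h'.parent_child ▸ hz)
  -- The link to `w` brings each upward vertex closer by `dist w' w - 1`. Vertices between the cones
  -- lose at most `dist w' w + 1`, and the others lose nothing.
  have h1 := R.le_deviate hB (fun x => if x ∈ upward s T w w' then 1 + s.graph.dist w x
      else if x ∈ T.cone w \ T.cone c' then s.graph.dist w' x + s.graph.dist w' w + 1
      else s.graph.dist w' x) (fun x hxw => by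
    by_cases hxu : x ∈ upward s T w w'
    · simp only [hxu, if_true]
      exact R.reaches_via hwne.symm (mem_upward T |>.1 hxu).2 hw
    simp only [hxu, if_false]
    by_cases hx : x ∈ T.cone w \ T.cone c'
    · simp only [hx, if_true]
      by_cases hxw' : T.Desc w' x
      · exact (hdesc x hxw' hxw).mono (by omega)
      · have hwx : T.Desc w x := by simpa using (Finset.mem_sdiff.1 hx).1
        refine (hw.trans (hwx.avoidWalk (w := w') (fun h => hxw' h.2))).mono ?_
        have h1 := hwx.dist_add R.conn
        have h2 := R.conn.dist_triangle (u := w) (v := w') (w := x)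
        rw [SimpleGraph.dist_comm (u := w) (v := w')] at h2
        omega
    · simp only [hx, if_false]
      by_cases hxc : T.Desc c' x
      · exact hdesc x (hdc'.trans hxc) hxw
      have hxw' : ¬ T.Desc w x := by simpa [hxc] using hx
      rcases hsplit x hxw' with h | ⟨z, hz, h⟩
      · exact absurd ((mem_upward T).2 ⟨hxw', h⟩) hxu
      · rw [h]
        exact R.reaches_via (hzw z hz) h (hdesc z (hdc'.trans hz) (hzw z hz)))
  have h2 : ∑ x, ((if x ∈ upward s T w w' then 1 + s.graph.dist w x
      else if x ∈ T.cone w \ T.cone c' then s.graph.dist w' x + s.graph.dist w' w + 1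
      else s.graph.dist w' x : ℕ) : ℝ) ≤
      ∑ x, ((s.graph.dist w' x : ℝ) +
        ((if x ∈ upward s T w w' then 1 - (s.graph.dist w' w : ℝ) else 0) +
        (if x ∈ T.cone w \ T.cone c' then (s.graph.dist w' w : ℝ) + 1 else 0))) := by
    refine Finset.sum_le_sum fun x _ => ?_
    by_cases hxu : x ∈ upward s T w w'
    · have h3 := (mem_upward T).1 hxu
      have h4 : x ∉ T.cone w \ T.cone c' := by simp [h3.1]
      have h5 : (s.graph.dist w' x : ℝ) = s.graph.dist w' w + s.graph.dist w x := by
        exact_mod_cast h3.2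
      simp only [hxu, h4, if_true, if_false]
      push_cast
      linarith
    · by_cases hx : x ∈ T.cone w \ T.cone c' <;> simp only [hxu, hx, if_true, if_false]
      · push_cast; linarith
      · simp
  rw [Finset.sum_add_distrib, Finset.sum_add_distrib, sum_ite_mem_const, sum_ite_mem_const] at h2
  have h3 : ((insert w ((s.buys w').erase v')).card : ℝ) ≤ (s.buys w').card := by
    exact_mod_cast swap_card_le h'.buys_other w
  have h5 := mul_le_mul_of_nonneg_left h3 R.pos.le
  rw [StrategyVector.distSum] at h1
  have h6 : (2 : ℝ) ≤ s.graph.dist w' w := by exact_mod_cast hfar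
  have h7 : (0 : ℝ) ≤ (T.cone w \ T.cone c').card := Nat.cast_nonneg _
  have h8 : ((s.graph.dist w' w : ℝ) - 1) * (upward s T w w').card ≤
      ((s.graph.dist w' w : ℝ) + 1) * (T.cone w \ T.cone c').card := by linarith
  -- For d ≥ 2, d + 1 ≤ 3(d - 1); this is the factor 3.
  have h9 : ((s.graph.dist w' w : ℝ) + 1) * (T.cone w \ T.cone c').card ≤
      ((s.graph.dist w' w : ℝ) - 1) * (3 * (T.cone w \ T.cone c').card) := by
    nlinarith
  exact le_of_mul_le_mul_left (h8.trans h9) (by linarith)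

/-- Without the parent link, `r` is still reached within `2 * Δ + 1` through an edge leaving the
cone of `w'`. With the detour `6 * Δ` and the depth of `w'` the loss is at most `10 * Δ` per vertex,
and only vertices between the cones or upward ones are affected. -/
lemma link_price_le_of_parent (h' : TwoLinks S T w' c' v')
    (hsplit : ∀ x, ¬ T.Desc w x → s.graph.dist w' x = s.graph.dist w' w + s.graph.dist w x ∨
      ∃ z, T.Desc c' z ∧ s.graph.dist w' x = s.graph.dist w' z + s.graph.dist z x)
    (hv' : v' = T.parent w') :
    α ≤ 10 * Δ * ((T.cone w \ T.cone c').card + (upward s T w w').card) := by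
  have hB : w' ∉ (s.buys w').erase v' := by simp [s.notMem_self w']
  have hBs : ∀ y ∈ s.buys w', y ≠ v' → y ≠ v' → y ∈ (s.buys w').erase v' :=
    fun y hy h1 _ => by simp [hy, h1]
  have hroot := R.reaches_root_of_children T h'.ne_root h'.child_ne_root h'.parent_child
    h'.child_mem (fun y hy h => hBs y hy (hv' ▸ h) (hv' ▸ h))
  have hc'x : ∀ x, T.Desc c' x → s.Reaches w' ((s.buys w').erase v') x (s.graph.dist w' x) :=
    fun x hx => R.reaches_of_child T h'.child_ne_root h'.parent_child
      (.inl (by simp [h'.ne, h'.buys_child])) hx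
  have h1 := R.le_deviate hB (fun x => if x ∈ T.cone w \ T.cone c' ∨ x ∈ upward s T w w' then
      2 * Δ + 1 + s.graph.dist r x + 6 * Δ else s.graph.dist w' x) (fun x hxw => by
    by_cases hx : x ∈ T.cone w \ T.cone c' ∨ x ∈ upward s T w w'
    · simp only [hx, if_true]
      refine (R.reaches_all T h'.ne_root h'.other_mem h'.other_mem hBs hroot hxw).mono ?_
      split_ifs <;> omega
    · simp only [hx, if_false]
      push Not at hx
      by_cases hxc : T.Desc c' x
      · exact hc'x x hxc
      have hxw' : ¬ T.Desc w x := by simpa [hxc] using hx.1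
      rcases hsplit x hxw' with h | ⟨z, hz, h⟩
      · exact absurd ((mem_upward T).2 ⟨hxw', h⟩) hx.2
      · rw [h]
        refine R.reaches_via ?_ h (hc'x z hz)
        rintro rfl
        exact T.not_desc_parent h'.child_ne_root (h'.parent_child ▸ hz))
  have h2 : ∑ x, ((if x ∈ T.cone w \ T.cone c' ∨ x ∈ upward s T w w' then
      2 * Δ + 1 + s.graph.dist r x + 6 * Δ else s.graph.dist w' x : ℕ) : ℝ) ≤
      ∑ x, ((s.graph.dist w' x : ℝ) +
        ((if x ∈ T.cone w \ T.cone c' then 10 * (Δ : ℝ) else 0) +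
        (if x ∈ upward s T w w' then 10 * (Δ : ℝ) else 0))) := by
    refine Finset.sum_le_sum fun x _ => ?_
    have h3 : (s.graph.dist r x : ℝ) ≤ s.graph.dist r w' + s.graph.dist w' x := by
      exact_mod_cast R.conn.dist_triangle
    have h4 : (s.graph.dist r w' : ℝ) ≤ Δ := by exact_mod_cast R.depth_le h'.mem
    have h5 : (1 : ℝ) ≤ Δ := by exact_mod_cast R.block.one_le
    by_cases h6 : x ∈ T.cone w \ T.cone c' <;> by_cases h7 : x ∈ upward s T w w' <;>
      simp only [h6, h7, if_true, if_false, or_true, true_or, or_self] <;> push_cast <;> linarith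
  rw [Finset.sum_add_distrib, Finset.sum_add_distrib, sum_ite_mem_const, sum_ite_mem_const] at h2
  have h3 : (((s.buys w').erase v').card : ℝ) + 1 = (s.buys w').card := by
    exact_mod_cast Finset.card_erase_add_one h'.buys_other
  rw [← h3, StrategyVector.distSum] at h1
  linarith

/-- Between two nested players with two links there are many vertices of the block, or many
vertices. -/
lemma nested_two_links (h : TwoLinks S T w c v) (h' : TwoLinks S T w' c' v')
    (hcw' : T.Desc c w') :
    α - n ≤ 4 * ((T.cone w \ T.cone c') ∩ S).card * (T.cone c).card
        + 6 * Δ * (T.coneOf w v).card ∨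
      α ≤ 40 * Δ * (T.cone w \ T.cone c').card := by
  -- Either `cone w` has a short exit from `c`, and the upper player is tested, or it has none, and
  -- the lower player is.
  by_cases hno : ∀ p m, ¬ T.Desc w p → AvoidWalk s.graph w c p m →
      ¬ m ≤ 2 * ((T.cone w \ T.cone c') ∩ S).card
  · right
    have hsplit := fun x => R.geodesic_split T (x := x) h.mem h.child_ne_root h.parent_child h'.mem
      h'.child_ne_root h'.parent_child hcw' rfl hno
    have h0 : (0 : ℝ) ≤ Δ * (T.cone w \ T.cone c').card := by positivity
    by_cases hkept : T.parent w' ∈ (s.buys w').erase v' ∨ w' ∈ s.buys (T.parent w')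
    · have := R.link_price_le_of_kept T h' h.child_ne_root h.parent_child hcw' hsplit hkept
      linarith
    have hv' : v' = T.parent w' := by
      by_contra hne
      refine hkept ((T.adj w' h'.ne_root).symm.imp (fun h1 => ?_) id)
      exact Finset.mem_erase.2 ⟨Ne.symm hne, h1⟩
    have hww' : T.Desc w w' := h.parent_child ▸ (T.desc_parent h.child_ne_root).trans hcw'
    have hwne : w' ≠ w := fun e =>
      T.not_desc_parent h.child_ne_root (by rw [h.parent_child, ← e]; exact hcw')
    -- Otherwise `w' = c`, and the parent link is the one bought by `w`, which `w'` cannot delete.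
    have hpw : T.parent w' ≠ w := by
      intro e
      have := BFSTree.eq_of_siblings h.child_ne_root h'.ne_root (h.parent_child.trans e.symm) hcw'
        .refl
      subst this
      exact hkept (.inr (by rw [e]; exact h.buys_child))
    have hfar : 2 ≤ s.graph.dist w' w := by
      have h1 := (hww'.parent_of_ne hwne).2.depth_lt hpw
      have h2 := T.dist_parent w' h'.ne_root
      have h3 := hww'.dist_add R.conn
      rw [SimpleGraph.dist_comm]
      omega
    have h1 := R.card_upward_le T h' h.child_ne_root h.parent_child hcw' hsplit hv' hfar
    have h2 := R.link_price_le_of_parent T h' hsplit hv'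
    have h3 := mul_le_mul_of_nonneg_left h1 (Nat.cast_nonneg Δ : (0 : ℝ) ≤ Δ)
    linarith
  · left
    push Not at hno
    obtain ⟨p, m, hp, hm, hmk⟩ := hno
    have h1 := R.exit_length T h.mem h.ne_root h.child_ne_root h.parent_child h.buys_child
      h.child_mem h.buys_other h.other_mem h.ne hp hm
    have h2 : (m : ℝ) ≤ 2 * ((T.cone w \ T.cone c') ∩ S).card := by exact_mod_cast hmk
    have h3 := mul_le_mul_of_nonneg_right h2 (Nat.cast_nonneg (T.cone c).card : (0 : ℝ) ≤ _)
    linarith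

end RootedBlock

/-! ### Counting in the tree -/

namespace BFSTree

variable {V : Type*} [Fintype V] [DecidableEq V] {G : SimpleGraph V} {r : V} {T : BFSTree G r}
  {u v w x : V}

lemma cone_subset (h : T.Desc v u) : T.cone u ⊆ T.cone v := fun _ hx =>
  mem_cone.2 (h.trans (mem_cone.1 hx))

lemma disjoint_cone_of_siblings (hu : u ≠ r) (hv : v ≠ r) (h : T.parent u = T.parent v)
    (huv : u ≠ v) : Disjoint (T.cone u) (T.cone v) :=
  Finset.disjoint_left.2 fun _ h1 h2 =>
    huv (eq_of_siblings hu hv h (mem_cone.1 h1) (mem_cone.1 h2))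

/-- Pairwise disjoint large cones are few. -/
lemma card_mul_le_of_disjoint {ι : Type*} (A : Finset ι) (f : ι → V) {β : ℝ}
    (hβ : ∀ i ∈ A, β ≤ (T.cone (f i)).card)
    (hd : ∀ i ∈ A, ∀ j ∈ A, i ≠ j → Disjoint (T.cone (f i)) (T.cone (f j))) :
    A.card * β ≤ Fintype.card V := by
  have h1 : ∑ i ∈ A, β ≤ ∑ i ∈ A, ((T.cone (f i)).card : ℝ) := Finset.sum_le_sum hβ
  have h2 : ∑ i ∈ A, (T.cone (f i)).card ≤ Fintype.card V := by
    rw [← Finset.card_biUnion hd]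
    exact Finset.card_le_univ _
  rw [Finset.sum_const, nsmul_eq_mul] at h1
  exact h1.trans (by exact_mod_cast h2)

/-- There are few vertices of small depth with large cones. -/
lemma card_mul_le_of_depth (A : Finset V) {β X : ℝ}
    (hβ : ∀ w ∈ A, β ≤ (T.cone w).card) (hX0 : 0 ≤ X) (hX : ∀ w ∈ A, (G.dist r w : ℝ) + 1 ≤ X) :
    A.card * β ≤ X * Fintype.card V := by
  have h1 : A.card = ∑ i ∈ Finset.range ⌊X⌋₊, {w ∈ A | G.dist r w = i}.card := by
    refine Finset.card_eq_sum_card_fiberwise fun w hw => ?_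
    have := Nat.le_floor (show ((G.dist r w + 1 : ℕ) : ℝ) ≤ X by push_cast; exact hX w hw)
    simp only [Finset.coe_range, Set.mem_Iio]
    omega
  rw [h1, Nat.cast_sum, Finset.sum_mul]
  refine (Finset.sum_le_sum (g := fun _ => (Fintype.card V : ℝ)) fun i _ => ?_).trans ?_
  -- Cones of distinct vertices at equal depth are disjoint, so each level contributes at most the
  -- number of all vertices.
  · refine card_mul_le_of_disjoint (T := T) _ id (fun w hw => hβ w (Finset.mem_filter.1 hw).1)
      fun w hw w' hw' hne => ?_
    refine Finset.disjoint_left.2 fun x h2 h3 => hne ?_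
    refine (mem_cone.1 h2).eq_of_depth_eq (mem_cone.1 h3) ?_
    simp only [id]
    rw [(Finset.mem_filter.1 hw).2, (Finset.mem_filter.1 hw').2]
  · rw [Finset.sum_const, Finset.card_range, nsmul_eq_mul]
    exact mul_le_mul_of_nonneg_right (Nat.floor_le hX0) (Nat.cast_nonneg _)

open scoped Classical in
/-- The children of `w` in `S` with at least `μ` descendants. -/
noncomputable def largeChildren (T : BFSTree G r) (S : Finset V) (μ : ℝ) (w : V) : Finset V :=
  {u ∈ S | u ≠ r ∧ T.parent u = w ∧ μ ≤ (T.cone u).card}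

lemma mem_largeChildren {S : Finset V} {μ : ℝ} : u ∈ T.largeChildren S μ w ↔
    u ∈ S ∧ u ≠ r ∧ T.parent u = w ∧ μ ≤ (T.cone u).card := by
  simp [largeChildren]

lemma largeChildren_eq_empty {S : Finset V} {μ : ℝ} (h : (T.cone v).card < μ) (hw : T.Desc v w) :
    T.largeChildren S μ w = ∅ := by
  refine Finset.eq_empty_of_forall_notMem fun u hu => ?_
  obtain ⟨-, h1, rfl, h2⟩ := mem_largeChildren.1 hu
  have h3 := Finset.card_le_card (cone_subset (hw.trans (T.desc_parent h1)))
  have h4 : ((T.cone u).card : ℝ) ≤ (T.cone v).card := by exact_mod_cast h3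
  linarith

lemma sum_largeChildren_card_inter_le {S : Finset V} {μ : ℝ} (A : Finset V) :
    ∑ u ∈ T.largeChildren S μ v, (T.cone u ∩ A).card ≤ (T.cone v ∩ A).card := by
  rw [← Finset.card_biUnion]
  · refine Finset.card_le_card (Finset.biUnion_subset.2 fun u hu => ?_)
    obtain ⟨-, h1, rfl, -⟩ := mem_largeChildren.1 hu
    exact Finset.inter_subset_inter_right (cone_subset (T.desc_parent h1))
  · intro u hu u' hu' hne
    obtain ⟨-, h1, h2, -⟩ := mem_largeChildren.1 hu
    obtain ⟨-, h3, h4, -⟩ := mem_largeChildren.1 hu'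
    exact (disjoint_cone_of_siblings h1 h3 (h2.trans h4.symm) hne).mono
      Finset.inter_subset_left Finset.inter_subset_left

/-- A proper descendant of `v` in `S` outside the cones of the large children lies below a small
child, so it has no large children itself and contributes nothing positive. -/
lemma sum_cone_le {S : Finset V} {μ : ℝ} (f : V → ℝ)
    (h0 : ∀ w, T.largeChildren S μ w = ∅ → f w ≤ 0) (hv : v ∈ S)
    (hanc : ∀ x ∈ S, ∀ y, T.Desc y x → y ∈ S) :
    ∑ w ∈ T.cone v ∩ S, f w ≤ f v + ∑ u ∈ T.largeChildren S μ v, ∑ w ∈ T.cone u ∩ S, f w := by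
  have hdisj : ∀ u ∈ T.largeChildren S μ v, ∀ u' ∈ T.largeChildren S μ v, u ≠ u' →
      Disjoint (T.cone u ∩ S) (T.cone u' ∩ S) := by
    intro u hu u' hu' hne
    obtain ⟨-, h1, h2, -⟩ := mem_largeChildren.1 hu
    obtain ⟨-, h3, h4, -⟩ := mem_largeChildren.1 hu'
    exact (disjoint_cone_of_siblings h1 h3 (h2.trans h4.symm) hne).mono
      Finset.inter_subset_left Finset.inter_subset_left
  rw [← Finset.sum_biUnion hdisj, ← Finset.sum_insert]
  · have hsub : insert v ((T.largeChildren S μ v).biUnion fun u => T.cone u ∩ S) ⊆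
        T.cone v ∩ S := by
      refine Finset.insert_subset (Finset.mem_inter.2 ⟨mem_cone.2 .refl, hv⟩)
        (Finset.biUnion_subset.2 fun u hu => ?_)
      obtain ⟨-, h1, rfl, -⟩ := mem_largeChildren.1 hu
      exact Finset.inter_subset_inter_right (cone_subset (T.desc_parent h1))
    rw [← Finset.sum_sdiff hsub]
    refine add_le_of_nonpos_left (Finset.sum_nonpos fun w hw => h0 w ?_)
    simp only [Finset.mem_sdiff, Finset.mem_inter, Finset.mem_insert, Finset.mem_biUnion,
      not_or, not_exists, not_and, mem_cone] at hw
    obtain ⟨⟨hvw, hwS⟩, hwv, hw⟩ := hw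
    obtain ⟨u, h1, h2, h3⟩ := hvw.exists_child hwv
    refine largeChildren_eq_empty (v := u) ?_ h3
    by_contra hlt
    exact hw u (mem_largeChildren.2 ⟨hanc w hwS u h3, h1, h2, not_lt.1 hlt⟩) h3 hwS
  · simp only [Finset.mem_biUnion, Finset.mem_inter, mem_cone, not_exists, not_and]
    intro u hu hd
    obtain ⟨-, h1, rfl, -⟩ := mem_largeChildren.1 hu
    exact absurd hd (T.not_desc_parent h1)

variable {S : Finset V} {μ : ℝ} {f Φ : V → ℝ} {Q : V → V → Prop}

/-- Induction on the cone. The second alternative records the topmost charged pair: a new pair above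
it has `Φ c' + 1 ≤ Φ w`, which pays for its unit. Both alternatives give at most `2 * Φ - 4`, so at
a branching with k ≥ 2 large children the reserve 4k pays for the k new units and restores the first
alternative. -/
lemma sum_cone_le_potential (hanc : ∀ x ∈ S, ∀ y, T.Desc y x → y ∈ S)
    (hmono : ∀ u v, T.Desc v u → Φ u ≤ Φ v)
    (hsum : ∀ v, ∑ u ∈ T.largeChildren S μ v, Φ u ≤ Φ v)
    (hbig : ∀ v, μ ≤ (T.cone v).card → 5 ≤ 2 * Φ v)
    (h0 : ∀ w, T.largeChildren S μ w = ∅ → f w ≤ 0)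
    (h1 : ∀ w, (T.largeChildren S μ w).card = 1 → 0 < f w → f w ≤ 1 ∧ ∃ c ∈ T.largeChildren S μ w,
      Q w c)
    (h2 : ∀ w, 2 ≤ (T.largeChildren S μ w).card → f w ≤ (T.largeChildren S μ w).card)
    (hQ : ∀ w c w' c', Q w c → Q w' c' → T.Desc c w' → Φ c' + 1 ≤ Φ w)
    (hQd : ∀ w c, Q w c → T.Desc w c)
    (hv : v ∈ S) (hvb : μ ≤ (T.cone v).card) :
    ∑ w ∈ T.cone v ∩ S, f w ≤ 2 * Φ v - 5 ∨
      ∃ w' c', Q w' c' ∧ T.Desc v w' ∧ ∑ w ∈ T.cone v ∩ S, f w ≤ Φ w' + Φ c' - 4 := by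
  induction hk : (T.cone v).card using Nat.strong_induction_on generalizing v with
  | _ k ih =>
    have hrec := sum_cone_le f h0 hv hanc
    have ih' : ∀ u ∈ T.largeChildren S μ v, ∑ w ∈ T.cone u ∩ S, f w ≤ 2 * Φ u - 5 ∨
        ∃ w' c', Q w' c' ∧ T.Desc u w' ∧ ∑ w ∈ T.cone u ∩ S, f w ≤ Φ w' + Φ c' - 4 := by
      intro u hu
      obtain ⟨h3, h4, h5, h6⟩ := mem_largeChildren.1 hu
      refine ih _ ?_ h3 h6 rfl
      rw [← hk]
      refine Finset.card_lt_card ⟨cone_subset (h5 ▸ T.desc_parent h4), fun h => ?_⟩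
      have := mem_cone.1 (h (mem_cone.2 (Desc.refl : T.Desc v v)))
      exact T.not_desc_parent h4 (h5.symm ▸ this)
    have ihw : ∀ u ∈ T.largeChildren S μ v, ∑ w ∈ T.cone u ∩ S, f w ≤ 2 * Φ u - 4 := by
      intro u hu
      rcases ih' u hu with h | ⟨w', c', h3, h4, h5⟩
      · linarith
      · have h6 := hmono _ _ h4
        have h7 := hmono _ _ (h4.trans (hQd _ _ h3))
        linarith
    rcases Nat.lt_or_ge (T.largeChildren S μ v).card 2 with hlt | hge
    · rcases Nat.eq_zero_or_pos (T.largeChildren S μ v).card with hz | hpos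
      · left
        rw [Finset.card_eq_zero] at hz
        rw [hz, Finset.sum_empty] at hrec
        have := h0 v hz
        have := hbig v hvb
        linarith
      · have hone : (T.largeChildren S μ v).card = 1 := by omega
        obtain ⟨c, hc⟩ := Finset.card_eq_one.1 hone
        have hcm : c ∈ T.largeChildren S μ v := by rw [hc]; simp
        obtain ⟨hcS, hcr, hcp, hcb⟩ := mem_largeChildren.1 hcm
        have hvc : T.Desc v c := hcp ▸ T.desc_parent hcr
        have hΦ := hmono _ _ hvc
        rw [hc, Finset.sum_singleton] at hrec
        by_cases hf : 0 < f v
        · obtain ⟨hf1, c₀, hc₀, hQv⟩ := h1 v hone hf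
          obtain rfl : c₀ = c := by rw [hc] at hc₀; simpa using hc₀
          refine .inr ⟨v, c₀, hQv, .refl, ?_⟩
          rcases ih' c₀ hcm with h | ⟨w', c', h3, h4, h5⟩
          · linarith
          · have h6 := hmono _ _ h4
            have h7 := hQ _ _ _ _ hQv h3 h4
            linarith
        · rcases ih' c hcm with h | ⟨w', c', h3, h4, h5⟩
          · left; linarith
          · exact .inr ⟨w', c', h3, hvc.trans h4, by linarith⟩
    · left
      have h3 := Finset.sum_le_sum ihw
      rw [Finset.sum_sub_distrib, ← Finset.mul_sum, Finset.sum_const, nsmul_eq_mul] at h3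
      have h4 := hsum v
      have h5 := h2 v hge
      have h6 : (2 : ℝ) ≤ (T.largeChildren S μ v).card := by exact_mod_cast hge
      linarith

lemma sum_le_potential (hanc : ∀ x ∈ S, ∀ y, T.Desc y x → y ∈ S)
    (hmono : ∀ u v, T.Desc v u → Φ u ≤ Φ v)
    (hsum : ∀ v, ∑ u ∈ T.largeChildren S μ v, Φ u ≤ Φ v)
    (hbig : ∀ v, μ ≤ (T.cone v).card → 5 ≤ 2 * Φ v)
    (h0 : ∀ w, T.largeChildren S μ w = ∅ → f w ≤ 0)
    (h1 : ∀ w, (T.largeChildren S μ w).card = 1 → 0 < f w → f w ≤ 1 ∧ ∃ c ∈ T.largeChildren S μ w,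
      Q w c)
    (h2 : ∀ w, 2 ≤ (T.largeChildren S μ w).card → f w ≤ (T.largeChildren S μ w).card)
    (hQ : ∀ w c w' c', Q w c → Q w' c' → T.Desc c w' → Φ c' + 1 ≤ Φ w)
    (hQd : ∀ w c, Q w c → T.Desc w c)
    (hr : r ∈ S) (hr0 : 0 ≤ Φ r) : ∑ w ∈ S, f w ≤ 2 * Φ r := by
  have hcone : T.cone r ∩ S = S :=
    Finset.inter_eq_right.2 fun x _ => mem_cone.2 (T.desc_root x)
  by_cases hb : μ ≤ (T.cone r).card
  · have h := sum_cone_le_potential hanc hmono hsum hbig h0 h1 h2 hQ hQd hr hb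
    rw [hcone] at h
    rcases h with h | ⟨w', c', h3, h4, h5⟩
    · linarith
    · have h6 := hmono _ _ h4
      have h7 := hmono _ _ (h4.trans (hQd _ _ h3))
      linarith
  · have : ∑ w ∈ S, f w ≤ 0 :=
      Finset.sum_nonpos fun w _ => h0 w (largeChildren_eq_empty (not_le.1 hb) (T.desc_root w))
    linarith

end BFSTree

/-! ### The size of a block -/

/-- Every vertex is attached to a block at a single vertex of the block. -/
lemma IsBlock.exists_gate {V : Type*} [Fintype V] {G : SimpleGraph V} {S : Finset V} {Δ : ℕ}
    (hS : IsBlock G S Δ) (hG : G.Connected) (x : V) :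
    ∃ p ∈ S, ∀ u ∈ S, G.dist u x = G.dist u p + G.dist p x := by
  classical
  obtain ⟨a, ha, -⟩ := hS.exists_far
  obtain ⟨p, hp, hpmin⟩ := S.exists_min_image (fun p => G.dist p x) ⟨a, ha⟩
  refine ⟨p, hp, fun u hu => ?_⟩
  obtain ⟨q, hq, hqmin⟩ := {q ∈ S | G.dist u x = G.dist u q + G.dist q x}.exists_min_image
    (fun q => G.dist q x) ⟨u, by simp [hu]⟩
  rw [Finset.mem_filter] at hq
  have split : ∀ {a : V} (t : G.Walk a x), t.length = G.dist a x → ∀ y ∈ t.support,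
      G.dist a x = G.dist a y + G.dist y x := by
    intro a t ht y hy
    have h1 := SimpleGraph.dist_le (t.takeUntil y hy)
    have h2 := SimpleGraph.dist_le (t.dropUntil y hy)
    have h3 := congrArg SimpleGraph.Walk.length (t.take_spec hy)
    rw [SimpleGraph.Walk.length_append] at h3
    have h4 := hG.dist_triangle (u := a) (v := y) (w := x)
    omega
  suffices h : q = p by rw [← h]; exact hq.2
  by_contra hne
  obtain ⟨t, ht⟩ := hG.exists_walk_length_eq_dist q x
  obtain ⟨t', ht'⟩ := hG.exists_walk_length_eq_dist p x
  have h1 : ∀ y ∈ t.support, y ∈ S → q = y := by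
    intro y hy hyS
    have h2 := split t ht y hy
    have h3 := hG.dist_triangle (u := u) (v := q) (w := y)
    have h4 := hG.dist_triangle (u := u) (v := y) (w := x)
    have h5 := hqmin y (Finset.mem_filter.2 ⟨hyS, by omega⟩)
    exact hG.dist_eq_zero_iff.1 (by omega)
  have h2 : ∀ y ∈ t'.support, y ∈ S → p = y := by
    intro y hy hyS
    have h3 := split t' ht' y hy
    have h4 := hpmin y hyS
    exact hG.dist_eq_zero_iff.1 (by omega)
  -- The two geodesics to `x` meet `S` only in `q` and `p`. A path from `q` to `p` inside their
  -- union stays in `S`, so its first edge joins `q` to `p`; but that edge lies on one of the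
  -- geodesics, which would then contain both vertices.
  have hcl := hS.path_closed (t.append t'.reverse).bypass
    (SimpleGraph.Walk.bypass_isPath _) hq.1 hp hne
  have hed := (t.append t'.reverse).edges_bypass_subset_edges
  have hsu := (t.append t'.reverse).support_bypass_subset_support
  generalize (t.append t'.reverse).bypass = W at hcl hed hsu
  cases W with
  | nil => exact hne rfl
  | @cons _ y _ hadj W =>
    have hyW : y ∈ (SimpleGraph.Walk.cons hadj W).support := by simp
    have hyS := hcl y hyW
    have hy := hsu hyW
    have he := hed (show s(q, y) ∈ (SimpleGraph.Walk.cons hadj W).edges by simp)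
    rw [SimpleGraph.Walk.mem_support_append_iff] at hy
    rw [SimpleGraph.Walk.edges_append, List.mem_append] at he
    have hyp : p = y := by
      rcases hy with hy | hy
      · exact absurd (h1 y hy hyS) hadj.ne
      · exact h2 y (by simpa using hy) hyS
    rcases he with he | he
    · exact hadj.ne (h1 y (t.snd_mem_support_of_mem_edges he) hyS)
    · have := t'.reverse.fst_mem_support_of_mem_edges he
      exact hne (h2 q (by simpa using this) hq.1).symm

namespace RootedBlock

variable {n : ℕ} {s : StrategyVector n} {α : ℝ} {S : Finset (Fin n)} {Δ : ℕ} {r : Fin n}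
  (R : RootedBlock s α S Δ r)

include R

/-- Buying a link must not pay off. -/
lemma mul_card_le {u z : Fin n} {t : ℕ} (X : Finset (Fin n))
    (hX : ∀ x ∈ X, s.graph.dist z x + 1 + t ≤ s.graph.dist u x) : t * (X.card : ℝ) ≤ α := by
  by_cases huz : u = z
  · subst huz
    have : X = ∅ := Finset.eq_empty_of_forall_notMem fun x hx => by have := hX x hx; omega
    rw [this]
    simpa using R.pos.le
  have hB : u ∉ insert z (s.buys u) := by simp [huz, s.notMem_self u]
  have h1 := R.le_deviate hB (fun x => if x ∈ X then 1 + s.graph.dist z x else s.graph.dist u x)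
    (fun x hx => by
      by_cases hxX : x ∈ X
      · simp only [hxX, if_true]
        have := hX x hxX
        exact (StrategyVector.Reaches.of_mem (.inl (by simp)) (Ne.symm huz)).trans
          (.of_dist_lt R.conn (by omega))
      · simp only [hxX, if_false]
        obtain ⟨T⟩ := exists_bfsTree R.conn x
        have h2 := T.dist_parent u hx.symm
        rw [SimpleGraph.dist_comm (u := x) (v := u),
          SimpleGraph.dist_comm (u := x) (v := T.parent u)] at h2
        have h3 := T.adj u hx.symm
        refine ((StrategyVector.Reaches.of_mem (h3.symm.imp (by simp +contextual) id) h3.ne).trans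
          (.of_dist_lt R.conn (z := T.parent u) (x := x) (by omega))).mono (by omega))
  have h2 : ∑ x, ((if x ∈ X then 1 + s.graph.dist z x else s.graph.dist u x : ℕ) : ℝ) ≤
      ∑ x, ((s.graph.dist u x : ℝ) + if x ∈ X then -(t : ℝ) else 0) := by
    refine Finset.sum_le_sum fun x _ => ?_
    by_cases hx : x ∈ X
    · have : (s.graph.dist z x : ℝ) + 1 + t ≤ s.graph.dist u x := by exact_mod_cast hX x hx
      simp only [hx, if_true]
      push_cast
      linarith
    · simp [hx]
  rw [Finset.sum_add_distrib, sum_ite_mem_const] at h2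
  have h3 : ((insert z (s.buys u)).card : ℝ) ≤ (s.buys u).card + 1 := by
    exact_mod_cast Finset.card_insert_le z (s.buys u)
  have h4 := mul_le_mul_of_nonneg_left h3 R.pos.le
  rw [StrategyVector.distSum] at h1
  linarith

lemma exists_far_from (z : Fin n) : ∃ u ∈ S, Δ ≤ 2 * s.graph.dist u z := by
  obtain ⟨a, ha, b, hb, hab⟩ := R.block.exists_far
  have h1 := R.conn.dist_triangle (u := a) (v := z) (w := b)
  rw [SimpleGraph.dist_comm (u := z) (v := b)] at h1
  rcases le_total (s.graph.dist a z) (s.graph.dist b z) with h | h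
  · exact ⟨b, hb, by omega⟩
  · exact ⟨a, ha, by omega⟩

/-- The first `ρ + 1` vertices of a geodesic from `p` to a far vertex of the block lie in the block
and in the ball. -/
lemma lt_card_ball {p : Fin n} (hp : p ∈ S) {ρ : ℕ} (hρ : 2 * ρ < Δ) :
    ρ + 1 ≤ {z ∈ S | s.graph.dist z p ≤ ρ}.card := by
  obtain ⟨v, hv, hvp⟩ := R.exists_far_from p
  obtain ⟨q, hq, hql⟩ := R.conn.exists_path_of_dist p v
  rw [SimpleGraph.dist_comm] at hvp
  have hne : p ≠ v := by
    rintro rfl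
    rw [SimpleGraph.dist_self] at hvp
    omega
  refine length_le_card q hq (by omega) fun j hj => ?_
  rw [Finset.mem_filter]
  refine ⟨R.block.path_closed q hq hp hv hne _ (q.getVert_mem_support j), ?_⟩
  rw [SimpleGraph.dist_comm]
  refine (SimpleGraph.dist_le (q.take j)).trans ?_
  rw [SimpleGraph.Walk.take_length]
  omega

/-- A block of large diameter has many vertices. -/
lemma mul_sq_le_card : (n : ℝ) * Δ ^ 2 ≤ 100 * α * S.card := by
  have hα := R.pos
  have hS1 : (1 : ℝ) ≤ S.card := by
    exact_mod_cast Finset.card_pos.2 ⟨r, R.root_mem⟩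
  rcases Nat.lt_or_ge Δ 10 with hΔ | hΔ
  · have h1 : (Δ : ℝ) ^ 2 ≤ 100 := by
      have : (Δ : ℝ) ≤ 10 := by exact_mod_cast hΔ.le
      nlinarith [(Nat.cast_nonneg Δ : (0 : ℝ) ≤ Δ)]
    have h2 := mul_le_mul R.lt.le h1 (by positivity) hα.le
    nlinarith
  choose gate hgS hgate using R.block.exists_gate R.conn
  set ρ := Δ / 10 with hρ
  -- Double counting of pairs formed by `z ∈ S` and a vertex with gate near `z`. A block vertex `u`
  -- at distance at least `Δ / 2` from `z` who buys a link to `z` gains at least `Δ / 5` for each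
  -- such vertex, so there are at most `5 * α / Δ` of them.
  have hX : ∀ z ∈ S, (Δ : ℝ) * ({x | s.graph.dist z (gate x) ≤ ρ} : Finset (Fin n)).card ≤
      5 * α := by
    intro z hz
    obtain ⟨u, hu, huz⟩ := R.exists_far_from z
    have h1 := R.mul_card_le (u := u) (z := z) (t := s.graph.dist u z - 2 * ρ - 1)
      {x | s.graph.dist z (gate x) ≤ ρ} (fun x hx => by
        have h2 : s.graph.dist z (gate x) ≤ ρ := by simpa using hx
        have h3 := hgate x u hu
        have h4 := hgate x z hz
        have h5 := R.conn.dist_triangle (u := u) (v := gate x) (w := z)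
        rw [SimpleGraph.dist_comm (u := gate x) (v := z)] at h5
        omega)
    have h2 : (Δ : ℝ) ≤ 5 * (s.graph.dist u z - 2 * ρ - 1 : ℕ) := by
      exact_mod_cast (by omega : Δ ≤ 5 * (s.graph.dist u z - 2 * ρ - 1))
    refine (mul_le_mul_of_nonneg_right h2 (Nat.cast_nonneg _)).trans ?_
    linarith
  have hball : ∀ x, ρ + 1 ≤ {z ∈ S | s.graph.dist z (gate x) ≤ ρ}.card := fun x =>
    R.lt_card_ball (hgS x) (by omega)
  have hdouble : ∑ x, ({z ∈ S | s.graph.dist z (gate x) ≤ ρ}.card : ℝ) =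
      ∑ z ∈ S, (({x | s.graph.dist z (gate x) ≤ ρ} : Finset (Fin n)).card : ℝ) := by
    simp only [Finset.card_filter, Nat.cast_sum]
    exact Finset.sum_comm
  have h1 : (n : ℝ) * (ρ + 1) ≤ ∑ x, ({z ∈ S | s.graph.dist z (gate x) ≤ ρ}.card : ℝ) := by
    have := Finset.sum_le_sum (s := Finset.univ) (f := fun _ : Fin n => ((ρ : ℝ) + 1))
      (g := fun x => ({z ∈ S | s.graph.dist z (gate x) ≤ ρ}.card : ℝ))
      (fun x _ => by exact_mod_cast hball x)
    simpa [mul_add] using this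
  have h2 : (Δ : ℝ) * ∑ z ∈ S, (({x | s.graph.dist z (gate x) ≤ ρ} : Finset (Fin n)).card : ℝ) ≤
      S.card * (5 * α) := by
    rw [Finset.mul_sum, ← nsmul_eq_mul]
    exact Finset.sum_le_card_nsmul _ _ _ hX
  have h3 : (Δ : ℝ) ≤ 10 * (ρ + 1) := by
    exact_mod_cast (by omega : Δ ≤ 10 * (ρ + 1))
  have h4 := mul_le_mul_of_nonneg_left (h1.trans_eq hdouble) (Nat.cast_nonneg Δ : (0 : ℝ) ≤ Δ)
  have h5 : (n : ℝ) * Δ ^ 2 ≤ 10 * (Δ * (n * (ρ + 1))) := by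
    have := mul_le_mul_of_nonneg_left h3 (by positivity : (0 : ℝ) ≤ n * Δ)
    nlinarith
  have h6 : (0 : ℝ) ≤ α * S.card := by positivity
  linarith

end RootedBlock

/-! ### The average out-degree of a block -/

/-- The player `w` has bought a link to her child `c` with a large cone, and another link into the
block which does not lead to a large cone. -/
def MixedLinks {n : ℕ} {s : StrategyVector n} {r : Fin n} (S : Finset (Fin n))
    (T : BFSTree s.graph r) (μ : ℝ) (w c v : Fin n) : Prop :=
  TwoLinks S T w c v ∧ ((T.coneOf w v).card : ℝ) < μ ∧ μ ≤ (T.cone c).card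

namespace RootedBlock

variable {n : ℕ} {s : StrategyVector n} {α : ℝ} {S : Finset (Fin n)} {Δ : ℕ} {r : Fin n}
  (R : RootedBlock s α S Δ r) (T : BFSTree s.graph r) {w w' c c' v v' x p : Fin n} {μ K a₀ : ℝ}

include R

lemma diam_pos : (1 : ℝ) ≤ Δ := by exact_mod_cast R.block.one_le

lemma gap_pos : 0 < α - n := sub_pos.2 R.lt

lemma threshold_pos (hμ : 24 * Δ * μ = α - n) : 0 < μ := by
  have h1 := R.diam_pos
  have h2 := R.gap_pos
  by_contra h
  nlinarith

/-- Two small cones would satisfy `6 * Δ * (2 * μ) = (α - n) / 2`, too little for `two_links`. -/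
lemma card_small_links_le_one (hμ : 24 * Δ * μ = α - n) (hw : w ∈ S) :
    {a ∈ {a ∈ s.buys w | a ∈ S} | ((T.coneOf w a).card : ℝ) < μ}.card ≤ 1 := by
  rw [Finset.card_le_one]
  intro a ha b hb
  simp only [Finset.mem_filter] at ha hb
  by_contra hab
  have h1 := R.diam_pos
  have h2 := R.gap_pos
  have h3 : (0 : ℝ) < 6 * Δ := by linarith
  have ha' := mul_lt_mul_of_pos_left ha.2 h3
  have hb' := mul_lt_mul_of_pos_left hb.2 h3
  by_cases hwr : w = r
  · subst hwr
    have := R.root_two_links T ha.1.1 ha.1.2 hb.1.1 hb.1.2 hab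
    have : (0 : ℝ) ≤ n := Nat.cast_nonneg n
    linarith
  · have := R.two_links T hw hwr ha.1.1 ha.1.2 hb.1.1 hb.1.2 hab
    linarith

lemma large_links_subset (hμ : 24 * Δ * μ = α - n) :
    {a ∈ {a ∈ s.buys w | a ∈ S} | ¬ ((T.coneOf w a).card : ℝ) < μ} ⊆
      T.largeChildren S μ w := by
  intro a ha
  simp only [Finset.mem_filter, not_lt] at ha
  have h1 := R.threshold_pos hμ
  by_cases h : a ≠ r ∧ T.parent a = w
  · rw [BFSTree.coneOf_eq h.1 h.2] at ha
    exact BFSTree.mem_largeChildren.2 ⟨ha.1.2, h.1, h.2, ha.2⟩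
  · rw [BFSTree.coneOf, if_neg h] at ha
    simp only [Finset.card_empty, Nat.cast_zero] at ha
    linarith

lemma card_links_le (hμ : 24 * Δ * μ = α - n) (hw : w ∈ S) :
    {a ∈ s.buys w | a ∈ S}.card ≤ 1 + (T.largeChildren S μ w).card := by
  rw [← Finset.card_filter_add_card_filter_not (fun a => ((T.coneOf w a).card : ℝ) < μ)]
  exact add_le_add (R.card_small_links_le_one T hμ hw)
    (Finset.card_le_card (R.large_links_subset T hμ))

lemma exists_mixedLinks (hμ : 24 * Δ * μ = α - n) (hw : w ∈ S)
    (hk : (T.largeChildren S μ w).card = 1) (h2 : 2 ≤ {a ∈ s.buys w | a ∈ S}.card) :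
    ∃ c ∈ T.largeChildren S μ w, ∃ v, MixedLinks S T μ w c v := by
  rw [← Finset.card_filter_add_card_filter_not (fun a => ((T.coneOf w a).card : ℝ) < μ)] at h2
  have h3 := R.card_small_links_le_one T hμ hw
  have h4 := Finset.card_le_card (R.large_links_subset T (w := w) hμ)
  obtain ⟨v, hv⟩ := Finset.card_pos.1 (by omega :
    0 < {a ∈ {a ∈ s.buys w | a ∈ S} | ((T.coneOf w a).card : ℝ) < μ}.card)
  obtain ⟨c, hc⟩ := Finset.card_pos.1 (by omega :
    0 < {a ∈ {a ∈ s.buys w | a ∈ S} | ¬ ((T.coneOf w a).card : ℝ) < μ}.card)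
  have hck := R.large_links_subset T hμ hc
  obtain ⟨h5, h6, h7, h8⟩ := BFSTree.mem_largeChildren.1 hck
  simp only [Finset.mem_filter] at hv hc
  have hcv : c ≠ v := by rintro rfl; exact hc.2 hv.2
  refine ⟨c, hck, v, ⟨hw, ?_, h6, h7, hc.1.1, h5, hv.1.1, hv.1.2, hcv⟩, hv.2, h8⟩
  -- At the root a second link already forces the cone of each link to be large.
  rintro rfl
  have h9 := R.root_two_links T hv.1.1 hv.1.2 hc.1.1 hc.1.2 hcv.symm
  have h10 := R.diam_pos
  have h11 := R.gap_pos
  have h12 := mul_lt_mul_of_pos_left hv.2 (by linarith : (0 : ℝ) < 6 * Δ)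
  have : (0 : ℝ) ≤ n := Nat.cast_nonneg n
  linarith

omit R in
lemma card_sdiff_inter (A B C : Finset (Fin n)) (h : B ⊆ A) :
    (((A \ B) ∩ C).card : ℝ) = (A ∩ C).card - (B ∩ C).card := by
  have h1 : (A \ B) ∩ C = (A ∩ C) \ (B ∩ C) := by
    ext x; simp only [Finset.mem_inter, Finset.mem_sdiff]; tauto
  rw [h1, Finset.cast_card_sdiff (Finset.inter_subset_inter_right h)]

/-- The potential which pays for the players with mixed links. -/
noncomputable def potential (S : Finset (Fin n)) (T : BFSTree s.graph r) (A K : ℝ) (v : Fin n) :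
    ℝ := A * (T.cone v).card + (T.cone v ∩ S).card / K

/-- The small cone costs at most `6 * Δ * μ = (α - n) / 4`, so the first alternative of
`nested_two_links` leaves `3 * (α - n) / 4 ≤ 4 * k * a₀` for the number `k` of block vertices in
between. The choice of `a₀` turns this into `K ≤ k`; the second alternative is paid by the vertex
term. -/
lemma potential_add_one_le (hK : 0 < K) (hμ : 24 * Δ * μ = α - n) (ha₀ : 16 * K * a₀ = 3 * (α - n))
    (h : MixedLinks S T μ w c v) (hc : (T.cone c).card ≤ a₀) (h' : MixedLinks S T μ w' c' v')
    (hd : T.Desc c w') :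
    potential S T (60 * Δ / (α - n)) K c' + 1 ≤ potential S T (60 * Δ / (α - n)) K w := by
  have hgap := R.gap_pos
  have hΔ := R.diam_pos
  have hsub : T.cone c' ⊆ T.cone w := by
    refine BFSTree.cone_subset ?_
    have h1 := T.desc_parent h.1.child_ne_root
    have h2 := T.desc_parent h'.1.child_ne_root
    rw [h.1.parent_child] at h1
    rw [h'.1.parent_child] at h2
    exact (h1.trans hd).trans h2
  have e1 := card_sdiff_inter (T.cone w) (T.cone c') S hsub
  have e2 := Finset.cast_card_sdiff (R := ℝ) hsub
  have key : 1 ≤ 60 * Δ / (α - n) * ((T.cone w \ T.cone c').card : ℝ) +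
      ((T.cone w \ T.cone c') ∩ S).card / K := by
    rcases R.nested_two_links T h.1 h'.1 hd with h3 | h3
    · have h4 := mul_lt_mul_of_pos_left h.2.1 (by linarith : (0 : ℝ) < 6 * Δ)
      have h5 : (((T.cone w \ T.cone c') ∩ S).card : ℝ) * (T.cone c).card ≤
          ((T.cone w \ T.cone c') ∩ S).card * a₀ :=
        mul_le_mul_of_nonneg_left hc (Nat.cast_nonneg _)
      have h6 : K ≤ ((T.cone w \ T.cone c') ∩ S).card := by
        by_contra hlt
        rw [not_le] at hlt
        have ha : 0 < a₀ := by
          by_contra hle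
          have : 16 * K * a₀ ≤ 0 := mul_nonpos_of_nonneg_of_nonpos (by linarith) (not_lt.1 hle)
          linarith
        have := mul_lt_mul_of_pos_right hlt ha
        linarith
      have h7 : 1 ≤ (((T.cone w \ T.cone c') ∩ S).card : ℝ) / K := by
        rwa [le_div_iff₀ hK, one_mul]
      have h8 : (0 : ℝ) ≤ 60 * Δ / (α - n) * ((T.cone w \ T.cone c').card : ℝ) := by positivity
      linarith
    · have h7 : 0 ≤ (((T.cone w \ T.cone c') ∩ S).card : ℝ) / K := by positivity
      have h8 : 1 ≤ 60 * Δ / (α - n) * ((T.cone w \ T.cone c').card : ℝ) := by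
        rw [div_mul_eq_mul_div, le_div_iff₀ hgap, one_mul]
        have : (0 : ℝ) ≤ Δ * (T.cone w \ T.cone c').card := by positivity
        have : (0 : ℝ) ≤ n := Nat.cast_nonneg n
        linarith
      linarith
  rw [e1, e2, sub_div, mul_sub] at key
  rw [potential, potential]
  linarith

open scoped Classical in
/-- The number of excess links of the players whose mixed links are paid for by the potential. -/
noncomputable def excess (S : Finset (Fin n)) (T : BFSTree s.graph r) (μ a₀ : ℝ) (w : Fin n) : ℝ :=
  if 2 ≤ (T.largeChildren S μ w).card then ((T.largeChildren S μ w).card : ℝ)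
  else if ∃ c ∈ T.largeChildren S μ w, ∃ v, MixedLinks S T μ w c v ∧ ((T.cone c).card : ℝ) ≤ a₀
  then 1 else 0

lemma sum_excess_le (hK : 0 < K) (hμ : 24 * Δ * μ = α - n) (ha₀ : 16 * K * a₀ = 3 * (α - n)) :
    ∑ w ∈ S, excess S T μ a₀ w ≤ 120 * Δ * n / (α - n) + 2 * S.card / K := by
  have hgap := R.gap_pos
  have hΔ := R.diam_pos
  have hA : (0 : ℝ) ≤ 60 * Δ / (α - n) := by positivity
  have h := BFSTree.sum_le_potential (T := T) (S := S) (μ := μ) (f := excess S T μ a₀)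
    (Φ := potential S T (60 * Δ / (α - n)) K)
    (Q := fun w c => ∃ v, MixedLinks S T μ w c v ∧ ((T.cone c).card : ℝ) ≤ a₀)
    (fun x hx y hy => R.mem_of_desc hx hy)
    (fun u v huv => by
      have h1 := BFSTree.cone_subset huv
      have h2 : ((T.cone u).card : ℝ) ≤ (T.cone v).card := by
        exact_mod_cast Finset.card_le_card h1
      have h3 : ((T.cone u ∩ S).card : ℝ) ≤ (T.cone v ∩ S).card := by
        exact_mod_cast Finset.card_le_card (Finset.inter_subset_inter_right h1)
      exact add_le_add (mul_le_mul_of_nonneg_left h2 hA) (div_le_div_of_nonneg_right h3 hK.le))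
    (fun v => by
      simp only [potential]
      rw [Finset.sum_add_distrib, ← Finset.mul_sum, ← Finset.sum_div]
      have h1 := BFSTree.sum_largeChildren_card_inter_le (T := T) (S := S) (μ := μ) (v := v)
        Finset.univ
      simp only [Finset.inter_univ] at h1
      have h2 := BFSTree.sum_largeChildren_card_inter_le (T := T) (S := S) (μ := μ) (v := v) S
      exact add_le_add (mul_le_mul_of_nonneg_left (by exact_mod_cast h1) hA)
        (div_le_div_of_nonneg_right (by exact_mod_cast h2) hK.le))
    (fun v hv => by
      have h1 : (0 : ℝ) ≤ (T.cone v ∩ S).card / K := by positivity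
      have h2 := mul_le_mul_of_nonneg_left hv hA
      -- The factor 60 makes a cone of size `μ` worth exactly the 5/2 that the induction needs at
      -- its leaves; it also exceeds the 40 of `nested_two_links`.
      have h3 : 60 * Δ / (α - n) * μ = 5 / 2 := by
        rw [div_mul_eq_mul_div, div_eq_iff hgap.ne']
        linarith
      rw [potential]
      linarith)
    (fun w hw => by
      rw [excess, hw]
      simp)
    (fun w hw hpos => by
      rw [excess, if_neg (by omega)] at hpos ⊢
      split_ifs at hpos ⊢ with h
      · exact ⟨le_rfl, h⟩
      · exact absurd hpos (lt_irrefl _))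
    (fun w hw => by rw [excess, if_pos hw])
    (fun w c w' c' h h' hd => by
      obtain ⟨v, h1, h2⟩ := h
      obtain ⟨v', h3, -⟩ := h'
      exact R.potential_add_one_le T hK hμ ha₀ h1 h2 h3 hd)
    (fun w c h => by
      obtain ⟨v, h1, -⟩ := h
      have := T.desc_parent h1.1.child_ne_root
      rwa [h1.1.parent_child] at this)
    R.root_mem (by rw [potential]; positivity)
  refine h.trans ?_
  have h1 : ((T.cone r).card : ℝ) ≤ n := by
    exact_mod_cast (Finset.card_le_univ _).trans_eq (Fintype.card_fin n)
  have h2 : ((T.cone r ∩ S).card : ℝ) ≤ S.card := by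
    exact_mod_cast Finset.card_le_card Finset.inter_subset_right
  have h3 := mul_le_mul_of_nonneg_left h1 hA
  have h4 := div_le_div_of_nonneg_right h2 hK.le
  have h5 : 120 * Δ * n / (α - n) = 2 * (60 * Δ / (α - n) * n) := by ring
  have h6 : 2 * S.card / K = 2 * (S.card / K) := by ring
  rw [potential, h5, h6]
  linarith

/-- The players with mixed links of small depth. -/
lemma card_shallow_le (ha₀ : 0 < a₀) (A : Finset (Fin n))
    (hA : ∀ w ∈ A, ∃ c v, MixedLinks S T μ w c v ∧ a₀ < (T.cone c).card ∧
      ((s.graph.dist r w : ℝ) + 1) * (T.cone c).card ≤ 2 * n) :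
    (A.card : ℝ) ≤ 2 * n ^ 2 / a₀ ^ 2 := by
  have h := BFSTree.card_mul_le_of_depth (T := T) A (β := a₀) (X := 2 * n / a₀)
    (fun w hw => by
      obtain ⟨c, v, h1, h2, -⟩ := hA w hw
      have h3 := T.desc_parent h1.1.child_ne_root
      rw [h1.1.parent_child] at h3
      refine h2.le.trans ?_
      exact_mod_cast Finset.card_le_card (BFSTree.cone_subset h3))
    (by positivity)
    (fun w hw => by
      obtain ⟨c, v, h1, h2, h3⟩ := hA w hw
      rw [le_div_iff₀ ha₀]
      exact (mul_le_mul_of_nonneg_left h2.le (by positivity)).trans h3)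
  rw [Fintype.card_fin, ← le_div_iff₀ ha₀] at h
  refine h.trans_eq ?_
  field_simp

/-- The players with mixed links whose second link leads to a moderately large cone. -/
lemma card_two_children_le (hμ : 24 * Δ * μ = α - n) (ha₀ : 0 < a₀) (A : Finset (Fin n))
    (hA : ∀ w ∈ A, ∃ c v, MixedLinks S T μ w c v ∧ a₀ < (T.cone c).card ∧
      2 * n < ((s.graph.dist r w : ℝ) + 1) * (T.cone c).card) :
    (A.card : ℝ) ≤ 32 * Δ * n ^ 2 / (a₀ * α) := by
  have hgap := R.gap_pos
  have hΔ := R.diam_pos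
  have hα := R.pos
  have hn : (0 : ℝ) < n := by exact_mod_cast (Fin.pos r)
  choose! c v hM hc hd using hA
  have hcone : ∀ w ∈ A, v w ≠ r ∧ T.parent (v w) = w := by
    intro w hw
    have h1 := (hM w hw).1
    -- If `v w` were not a child of `w`, its `coneOf` would be empty, leaving at most `n` where more
    -- than `2 * n` is assumed.
    have h2 := R.depth_mul_cone_le T h1.mem h1.ne_root h1.child_ne_root h1.parent_child
      h1.buys_other h1.other_mem h1.ne
    have h3 := hd w hw
    by_contra h4
    rw [BFSTree.coneOf, if_neg h4] at h2
    simp only [Finset.card_empty, Nat.cast_zero, mul_zero, add_zero] at h2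
    linarith
  have hlarge : ∀ w ∈ A, a₀ * α / (32 * Δ * n) ≤ (T.cone (v w)).card := by
    intro w hw
    obtain ⟨hvr, hvw⟩ := hcone w hw
    have h1 := (hM w hw).1
    have h2 := R.depth_mul_cone_le T h1.mem h1.ne_root h1.child_ne_root h1.parent_child
      h1.buys_other h1.other_mem h1.ne
    have h3 := hd w hw
    have h4 := R.child_link T h1.ne_root h1.buys_other h1.other_mem hvr hvw
    have h5 := mul_lt_mul_of_pos_left (hM w hw).2.1 (by linarith : (0 : ℝ) < 6 * Δ)
    rw [BFSTree.coneOf_eq hvr hvw] at h2 h4 h5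
    have h6 : (0 : ℝ) ≤ s.graph.dist r w := Nat.cast_nonneg _
    -- From `child_link`, as the small cone accounts for at most `(α - n) / 4`. Combined with `h8`,
    -- this eliminates the depth and leaves a lower bound for the cone of `v w`.
    have h7 : 3 * α / 8 ≤ s.graph.dist r w * n := by linarith
    have h8 : ((s.graph.dist r w : ℝ) + 1) * a₀ ≤ 12 * Δ * (T.cone (v w)).card := by
      have := mul_le_mul_of_nonneg_left (hc w hw).le (by positivity :
        (0 : ℝ) ≤ (s.graph.dist r w : ℝ) + 1)
      linarith
    rw [div_le_iff₀ (by positivity)]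
    have h9 := mul_le_mul_of_nonneg_right h8 hn.le
    have h10 := mul_le_mul_of_nonneg_right h7 ha₀.le
    have h11 : 0 ≤ a₀ * n := by positivity
    linarith
  have h := BFSTree.card_mul_le_of_disjoint (T := T) A v hlarge (fun w hw w' hw' hne => by
    -- If the cones met, one would contain the other mixed player `w'` together with her large
    -- child; but the cone of `v w` is smaller than `μ`.
    have main : ∀ w ∈ A, ∀ w' ∈ A, w ≠ w' → ∀ x, T.Desc (v w) x → T.Desc (v w') x →
        s.graph.dist r (v w) ≤ s.graph.dist r (v w') → False := by
      intro w hw w' hw' hne x hx hx' hle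
      obtain ⟨hvr, hvw⟩ := hcone w hw
      obtain ⟨hvr', hvw'⟩ := hcone w' hw'
      have h1 := hx.linear hx' hle
      have h2 : v w' ≠ v w := fun e => hne (by rw [← hvw, ← hvw', e])
      have h3 := (h1.parent_of_ne h2).2
      rw [hvw'] at h3
      have h4 := T.desc_parent (hM w' hw').1.child_ne_root
      rw [(hM w' hw').1.parent_child] at h4
      have h5 : ((T.cone (c w')).card : ℝ) ≤ (T.cone (v w)).card := by
        exact_mod_cast Finset.card_le_card (BFSTree.cone_subset (h3.trans h4))
      have h6 := (hM w hw).2.1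
      rw [BFSTree.coneOf_eq hvr hvw] at h6
      have h7 := (hM w' hw').2.2
      linarith
    refine Finset.disjoint_left.2 fun x h1 h2 => ?_
    rw [BFSTree.mem_cone] at h1 h2
    rcases le_total (s.graph.dist r (v w)) (s.graph.dist r (v w')) with hle | hle
    · exact main w hw w' hw' hne x h1 h2 hle
    · exact main w' hw' w hw hne.symm x h2 h1 hle)
  rw [Fintype.card_fin, ← le_div_iff₀ (by positivity)] at h
  refine h.trans_eq ?_
  field_simp

-- Each link beyond the first is charged to one of three accounts: the potential (branchings, and
-- mixed players with `cone c` at most `a₀`), the shallow players `A₁`, or the deep players `A₂`.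
open scoped Classical in
lemma sum_links_le (hK : 0 < K) (hμ : 24 * Δ * μ = α - n) (ha₀ : 16 * K * a₀ = 3 * (α - n)) :
    ∑ w ∈ S, ({a ∈ s.buys w | a ∈ S}.card : ℝ) ≤ S.card +
      (120 * Δ * n / (α - n) + 2 * S.card / K + 2 * n ^ 2 / a₀ ^ 2 +
        32 * Δ * n ^ 2 / (a₀ * α)) := by
  have hgap := R.gap_pos
  have ha : 0 < a₀ := by
    by_contra hle
    have : 16 * K * a₀ ≤ 0 := mul_nonpos_of_nonneg_of_nonpos (by linarith) (not_lt.1 hle)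
    linarith
  obtain ⟨T⟩ := exists_bfsTree R.conn r
  set A₁ : Finset (Fin n) := {w ∈ S | ∃ c v, MixedLinks S T μ w c v ∧ a₀ < (T.cone c).card ∧
      ((s.graph.dist r w : ℝ) + 1) * (T.cone c).card ≤ 2 * n} with hA₁
  set A₂ : Finset (Fin n) := {w ∈ S | ∃ c v, MixedLinks S T μ w c v ∧ a₀ < (T.cone c).card ∧
      2 * n < ((s.graph.dist r w : ℝ) + 1) * (T.cone c).card} with hA₂
  have h1 := R.card_shallow_le T ha A₁ fun w hw => (Finset.mem_filter.1 hw).2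
  have h2 := R.card_two_children_le T hμ ha A₂ fun w hw => (Finset.mem_filter.1 hw).2
  have h3 := R.sum_excess_le T hK hμ ha₀
  have h4 : ∀ w ∈ S, ({a ∈ s.buys w | a ∈ S}.card : ℝ) ≤ 1 + excess S T μ a₀ w +
      ((if w ∈ A₁ then 1 else 0) + (if w ∈ A₂ then 1 else 0)) := by
    intro w hw
    have h5 : (0 : ℝ) ≤ if w ∈ A₁ then 1 else 0 := by split_ifs <;> norm_num
    have h6 : (0 : ℝ) ≤ if w ∈ A₂ then 1 else 0 := by split_ifs <;> norm_num
    have h7 := R.card_links_le T hμ hw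
    have h7' : ({a ∈ s.buys w | a ∈ S}.card : ℝ) ≤ 1 + (T.largeChildren S μ w).card := by
      exact_mod_cast h7
    by_cases hk2 : 2 ≤ (T.largeChildren S μ w).card
    · rw [excess, if_pos hk2]
      linarith
    have h8 : 0 ≤ excess S T μ a₀ w := by
      rw [excess, if_neg hk2]; split_ifs <;> norm_num
    by_cases ho : {a ∈ s.buys w | a ∈ S}.card ≤ 1
    · have : ({a ∈ s.buys w | a ∈ S}.card : ℝ) ≤ 1 := by exact_mod_cast ho
      linarith
    have hk1 : (T.largeChildren S μ w).card = 1 := by omega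
    rw [hk1] at h7'
    obtain ⟨c, hc, v, hM⟩ := R.exists_mixedLinks T hμ hw hk1 (by omega)
    by_cases hca : ((T.cone c).card : ℝ) ≤ a₀
    · have : excess S T μ a₀ w = 1 := by
        rw [excess, if_neg hk2, if_pos ⟨c, hc, v, hM, hca⟩]
      push_cast at h7'
      linarith
    rw [not_le] at hca
    push_cast at h7'
    rcases le_or_gt (((s.graph.dist r w : ℝ) + 1) * (T.cone c).card) (2 * n) with hle | hlt
    · have : w ∈ A₁ := Finset.mem_filter.2 ⟨hw, c, v, hM, hca, hle⟩
      rw [if_pos this]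
      linarith
    · have : w ∈ A₂ := Finset.mem_filter.2 ⟨hw, c, v, hM, hca, hlt⟩
      rw [if_pos this]
      linarith
  have h5 := Finset.sum_le_sum h4
  rw [Finset.sum_add_distrib, Finset.sum_add_distrib, Finset.sum_add_distrib, Finset.sum_const,
    nsmul_eq_mul, mul_one, ← Finset.sum_filter, ← Finset.sum_filter, Finset.sum_const,
    Finset.sum_const, nsmul_eq_mul, nsmul_eq_mul, mul_one, mul_one,
    Finset.filter_mem_eq_inter, Finset.filter_mem_eq_inter] at h5
  have h6 : ((S ∩ A₁).card : ℝ) ≤ A₁.card := by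
    exact_mod_cast Finset.card_le_card Finset.inter_subset_right
  have h7 : ((S ∩ A₂).card : ℝ) ≤ A₂.card := by
    exact_mod_cast Finset.card_le_card Finset.inter_subset_right
  linarith

/-- No cone has `μ` vertices, so nobody has a large child. -/
lemma card_links_le_one (hμ : 24 * Δ * μ = α - n) (hn : (n : ℝ) < μ) (hw : w ∈ S) :
    {a ∈ s.buys w | a ∈ S}.card ≤ 1 := by
  obtain ⟨T⟩ := exists_bfsTree R.conn r
  have h := R.card_links_le T hμ hw
  rw [BFSTree.largeChildren_eq_empty (v := r) ?_ (T.desc_root w)] at h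
  · simpa using h
  · refine lt_of_le_of_lt ?_ hn
    exact_mod_cast (Finset.card_le_univ _).trans_eq (Fintype.card_fin n)

end RootedBlock

/-! ### Choosing the diameter bound -/

/-- This is log x ≥ 1 - 1/x at x = α/(α-n). -/
lemma div_le_log_div {n α : ℝ} (hn : 0 ≤ n) (h : n < α) : n / α ≤ Real.log (α / (α - n)) := by
  have hα : 0 < α := hn.trans_lt h
  have hP : 0 < α - n := sub_pos.2 h
  have h1 := Real.one_sub_inv_le_log_of_pos (div_pos hα hP)
  rw [inv_div] at h1
  refine le_trans (le_of_eq ?_) h1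
  field_simp
  ring

/-- The upper bound for the number of links beyond one per player, under the hypothesis on the
diameter. -/
lemma excess_bound {n α K Δ σ a₀ : ℝ} (hK : 0 < K) (hn : 0 ≤ n) (hα : n < α) (hΔ : 1 ≤ Δ)
    (ha₀ : 16 * K * a₀ = 3 * (α - n)) (hsmall : α - n ≤ 24 * Δ * n)
    (hdiam : K ^ 2 * α * n < Δ * (α - n) ^ 2) (hσ : n * Δ ^ 2 ≤ 100 * α * σ) :
    120 * Δ * n / (α - n) + 2 * σ / K + 2 * n ^ 2 / a₀ ^ 2 + 32 * Δ * n ^ 2 / (a₀ * α) ≤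
      199999 * σ / K := by
  have hα0 : 0 < α := hn.trans_lt hα
  obtain ⟨P, hP⟩ : ∃ P, P = α - n := ⟨_, rfl⟩
  rw [← hP] at ha₀ hsmall hdiam ⊢
  have hP0 : 0 < P := by rw [hP]; linarith
  have hPα : P ≤ α := by rw [hP]; linarith
  have hΔ0 : 0 < Δ := by linarith
  have hσ0 : 0 ≤ σ := by
    by_contra h
    have h1 := mul_pos hα0 (neg_pos.2 (not_le.1 h))
    have h2 : 0 ≤ n * Δ ^ 2 := by positivity
    linarith
  obtain rfl : a₀ = 3 * P / (16 * K) := by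
    rw [eq_div_iff (by positivity)]
    linarith
  -- Compare squares: `hsmall` gives `α ≤ 25 * Δ * n`, so (Kα)² ≤ 25Δ · K²αn < 25Δ²P² by `hdiam`.
  have hKα : K * α ≤ 5 * Δ * P := by
    have h1 : α ≤ 25 * Δ * n := by nlinarith
    refine abs_le_of_sq_le_sq' ?_ (by positivity) |>.2
    have h2 := mul_le_mul_of_nonneg_left h1 (by positivity : 0 ≤ K ^ 2 * α)
    have h3 := mul_le_mul_of_nonneg_left hdiam.le (by positivity : 0 ≤ 25 * Δ)
    linarith
  have hKΔ : K ≤ 5 * Δ := by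
    have h1 := mul_le_mul_of_nonneg_left hPα (by positivity : 0 ≤ 5 * Δ)
    exact le_of_mul_le_mul_right (hKα.trans h1) hα0
  have e1 : 120 * Δ * n / P ≤ 60000 * σ / K := by
    rw [div_le_div_iff₀ hP0 hK]
    refine le_of_mul_le_mul_right ?_ hα0
    have h1 := mul_le_mul_of_nonneg_left hKα (by positivity : 0 ≤ 120 * Δ * n)
    have h2 := mul_le_mul_of_nonneg_left hσ (by positivity : 0 ≤ 600 * P)
    linarith
  have e2 : 2 * n ^ 2 / (3 * P / (16 * K)) ^ 2 ≤ 28500 * σ / K := by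
    have : 2 * n ^ 2 / (3 * P / (16 * K)) ^ 2 = 512 * K ^ 2 * n ^ 2 / (9 * P ^ 2) := by
      field_simp
      ring
    rw [this, div_le_div_iff₀ (by positivity) hK]
    refine le_of_mul_le_mul_right ?_ hα0
    have h1 := mul_le_mul_of_nonneg_left hdiam.le (by positivity : 0 ≤ 512 * K * n)
    have h2 := mul_le_mul_of_nonneg_left hKΔ (by positivity : 0 ≤ 512 * n * Δ * P ^ 2)
    have h3 := mul_le_mul_of_nonneg_left hσ (by positivity : 0 ≤ 2560 * P ^ 2)
    have h4 : 0 ≤ σ * P ^ 2 * α := by positivity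
    linarith
  have e3 : 32 * Δ * n ^ 2 / (3 * P / (16 * K) * α) ≤ 17100 * σ / K := by
    have : 32 * Δ * n ^ 2 / (3 * P / (16 * K) * α) = 512 * Δ * K * n ^ 2 / (3 * P * α) := by
      field_simp
      ring
    rw [this, div_le_div_iff₀ (by positivity) hK]
    refine le_of_mul_le_mul_right ?_ hα0
    have h1 := mul_le_mul_of_nonneg_left hdiam.le (by positivity : 0 ≤ 512 * Δ * n)
    have h2 := mul_le_mul_of_nonneg_left hσ (by positivity : 0 ≤ 512 * P ^ 2)
    have h3 := mul_le_mul_of_nonneg_left hPα (by positivity : 0 ≤ 51300 * σ * P * α)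
    have h4 : 0 ≤ σ * P ^ 2 * α := by positivity
    linarith
  have e4 : 60000 * σ / K + 2 * σ / K + 28500 * σ / K + 17100 * σ / K ≤ 199999 * σ / K := by
    rw [← add_div, ← add_div, ← add_div]
    exact div_le_div_of_nonneg_right (by linarith) hK.le
  linarith

open scoped Classical in
lemma RootedBlock.sum_links_le_mul {n : ℕ} {s : StrategyVector n} {α : ℝ} {S : Finset (Fin n)}
    {Δ : ℕ} {r : Fin n} (R : RootedBlock s α S Δ r) {K : ℝ} (hK : 0 < K)
    (hd : K ^ 2 * (α / (α - n)) ^ 2 * Real.log (α / (α - n)) < Δ) :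
    ∑ w ∈ S, ({a ∈ s.buys w | a ∈ S}.card : ℝ) ≤ (1 + 199999 / K) * S.card := by
  have hn : (0 : ℝ) ≤ n := Nat.cast_nonneg n
  have hP := R.gap_pos
  have hα := R.pos
  have hΔ := R.diam_pos
  have hμ : 24 * Δ * ((α - n) / (24 * Δ)) = α - n := by field_simp
  have ha₀ : 16 * K * (3 * (α - n) / (16 * K)) = 3 * (α - n) := by field_simp
  rw [add_mul, one_mul]
  -- If the threshold `μ` exceeds `n` there is no excess at all; otherwise `n ≥ μ` is the hypothesis
  -- `hsmall` of `excess_bound`.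
  rcases lt_or_ge (n : ℝ) ((α - n) / (24 * Δ)) with h | h
  · have h1 : ∑ w ∈ S, ({a ∈ s.buys w | a ∈ S}.card : ℝ) ≤ ∑ w ∈ S, 1 :=
      Finset.sum_le_sum fun w hw => by exact_mod_cast R.card_links_le_one hμ h hw
    have h2 : 0 ≤ 199999 / K * (S.card : ℝ) := by positivity
    rw [Finset.sum_const, nsmul_eq_mul, mul_one] at h1
    linarith
  · refine (R.sum_links_le hK hμ ha₀).trans ?_
    rw [add_le_add_iff_left, div_mul_eq_mul_div 199999 K]
    refine excess_bound hK hn R.lt hΔ ha₀ ?_ ?_ R.mul_sq_le_card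
    · rw [div_le_iff₀ (by positivity)] at h
      linarith
    · have h1 := mul_le_mul_of_nonneg_left (div_le_log_div hn R.lt)
        (by positivity : 0 ≤ K ^ 2 * (α / (α - n)) ^ 2)
      have h2 := h1.trans_lt hd
      have h3 : K ^ 2 * (α / (α - n)) ^ 2 * (n / α) = K ^ 2 * α * n / (α - n) ^ 2 := by
        field_simp
      rwa [h3, div_lt_iff₀ (by positivity)] at h2

end NetworkCreation

theorem mainTheorem4 :
    ∃ R' : ℝ, ∃ d : ℝ → ℕ → ℝ → ℝ,
      (∃ C : ℝ, ∀ (K : ℝ) (n : ℕ) (α : ℝ), 0 < K → (n : ℝ) < α →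
        |d K n α| ≤ C * (K ^ 2 * (α / (α - n)) ^ 2 * Real.log (α / (α - n)))) ∧
      ∀ (K : ℝ) (n : ℕ) (α : ℝ), 0 < K → (n : ℝ) < α →
        ∀ s : NetworkCreation.StrategyVector n, s.IsNash α →
          ∀ H : s.graph.Subgraph, NetworkCreation.IsNontrivialBiconnectedComponent H →
            d K n α < (H.coe.diam : ℝ) →
              s.avgOutDegree H ≤ 1 + (R' - 1) / K := by
  classical
  refine ⟨200000, fun K n α => K ^ 2 * (α / (α - n)) ^ 2 * Real.log (α / (α - n)),
    ⟨1, fun K n α _ hα => ?_⟩, fun K n α hK hα s hs H hH hd => ?_⟩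
  · have hn : (0 : ℝ) ≤ n := Nat.cast_nonneg n
    have h := NetworkCreation.div_le_log_div hn hα
    have h' : 0 ≤ Real.log (α / (α - n)) := (div_nonneg hn (hn.trans hα.le)).trans h
    rw [one_mul, abs_of_nonneg (by positivity)]
  · obtain ⟨x, hx⟩ := hH.1.1.1.nonempty
    have hG := NetworkCreation.StrategyVector.IsNash.connected hs ⟨x⟩
    rw [NetworkCreation.StrategyVector.avgOutDegree]
    generalize hS : H.verts.toFinset = S
    have hmem : ∀ y, y ∈ S ↔ y ∈ H.verts := fun y => hS ▸ Set.mem_toFinset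
    obtain ⟨r, hr, hmin⟩ := S.exists_min_image s.distSum ⟨x, (hmem x).2 hx⟩
    have h := NetworkCreation.RootedBlock.sum_links_le_mul
      ⟨hs, hα, hG, hH.isBlock hG hmem, hr, hmin⟩ hK hd
    have hpos : (0 : ℝ) < S.card := Nat.cast_pos.2 (Finset.card_pos.2 ⟨x, (hmem x).2 hx⟩)
    rw [div_le_iff₀ hpos, show (200000 : ℝ) - 1 = 199999 by norm_num]
    refine le_of_eq_of_le (Finset.sum_congr rfl fun w _ => ?_) h
    simp only [NetworkCreation.StrategyVector.outDegree, hmem]
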